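/- Let $J\ge 0$ be an integer, $N=2^J-1$, let $n>1$ be real with $N\le n^2$, and let $0<\alpha<1$. Observe $$y_{j,k}=\theta_{j,k}+n^{-1/2}z_{j,k},\qquad 0\le j\le J-1,\ 1\le k\le 2^j,$$ with $z_{j,k}$ i.i.d. $N(0,1)$ and $\theta=(\theta_{j,k})\in\mathbb R^N$. Let $z_{a}=\Phi^{-1}(1-a)$, where $\Phi$ is the standard normal distribution function, let $\lambda_*=6.9368\ldots$ be the root greater than $1$ of $\lambda-\log\lambda=5$, and let $L=\lceil\log n\rceil$. For $0\le j\le J-1$ and $1\le i\le \lfloor 2^j/L\rfloor$ let $B_i^j=\{(j,k):(i-1)L+1\le k\le iL\}$ and $S_{j,i}^2=\sum_{(j,k)\in B_i^j}y_{j,k}^2$. Let $R=\sum_{j=0}^{J-1}(2^j-L\lfloor 2^j/L\rfloor)$ be the number of coefficients that lie in no block. Define $\hat\theta_{j,k}=y_{j,k}\,I(S_{j,i}^2\ge\lambda_*Ln^{-1})$ for $(j,k)\in B_i^j$ and $\hat\theta_{j,k}=y_{j,k}$ if $(j,k)$ lies in no block. Let $r_\alpha\ge 0$ be given by $$\begin{aligned}r_\alpha^2={}&\Big[2\log^{1/2}\big(\tfrac2\alpha\big)+4\lambda_*^{1/2}z_{\alpha/2}\Big]N^{1/2}n^{-1}+\sum_{j=0}^{J-1}\Big(\sum_i(S_{j,i}^2-Ln^{-1})I(S_{j,i}^2\le\lambda_*Ln^{-1})\Big)_+\\&+(2\lambda_*+8\lambda_*^{1/2}-1)\,n^{-1}\Big(L\,\mathrm{Card}\{(j,i):S_{j,i}^2>\lambda_*Ln^{-1}\}+R\Big),\end{aligned}$$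 and let $CB_*=\{\theta:\|\theta-\hat\theta\|_2\le r_\alpha\}$. (i) If $\log n\le N$, then $$\inf_{\theta\in\mathbb R^N}P_\theta(\theta\in CB_*)\ \ge\ 1-\alpha-2(\log n)^{-1}.$$ (ii) For every $\tau>0$ there is a constant $C_\tau>0$, depending only on $\tau$, such that for all such $n,J,\alpha$, all $2\le p\le\infty$, $0<q\le\infty$ and $M\ge1$, $$\sup_{\theta\in B^\tau_{p,q}(M)}E_\theta(r_\alpha^2)\ \le\ \Big[2\log^{1/2}\big(\tfrac2\alpha\big)+4\lambda_*^{1/2}z_{\alpha/2}+4\Big]N^{1/2}n^{-1}+C_\tau\min\big(Nn^{-1},\,M^{2/(1+2\tau)}n^{-2\tau/(1+2\tau)}\big),$$ where, with $s=\tau+\frac12-\frac1p$, $$B^\tau_{p,q}(M)=\Big\{\theta:\Big(\sum_{j=0}^{J-1}\Big(2^{js}\Big(\sum_{k=1}^{2^j}|\theta_{j,k}|^p\Big)^{1/p}\Big)^q\Big)^{1/q}\le M\Big\}$$ (with suprema in place of sums if $p=\infty$ or $q=\infty$). -/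

import Mathlib

open MeasureTheory ProbabilityTheory
open scoped ENNReal

noncomputable section

namespace HonestBall

/-- The index set `{(j, k) : 0 ≤ j ≤ J - 1, 1 ≤ k ≤ 2 ^ j}`, with `k` shifted to start at `0`. -/
abbrev Idx (J : ℕ) : Type := Σ j : Fin J, Fin (2 ^ (j : ℕ))

/-- The number `N = 2 ^ J - 1` of coefficients, as a real number. -/
def dim (J : ℕ) : ℝ := 2 ^ J - 1

/-- The law of the noise `z`: independent standard normal coordinates. -/
def noise (J : ℕ) : Measure (Idx J → ℝ) := Measure.pi fun _ => gaussianReal 0 1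

/-- The observations `y_{j,k} = θ_{j,k} + n^{-1/2} z_{j,k}`. -/
def obs {J : ℕ} (n : ℝ) (θ z : Idx J → ℝ) : Idx J → ℝ := fun a => θ a + z a / √n

/-- The Besov body `B^τ_{p,q}(M)`. The exponents may be infinite, with the usual suprema, and then
`(p.toReal)⁻¹ = 0`. -/
def besovBody (J : ℕ) (τ : ℝ) (p q : ℝ≥0∞) (M : ℝ) : Set (Idx J → ℝ) :=
  {θ | ‖(WithLp.toLp q fun j : Fin J =>
      (2 : ℝ) ^ ((j : ℝ) * (τ + 1 / 2 - (p.toReal)⁻¹)) *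
        ‖(WithLp.toLp p fun k : Fin (2 ^ (j : ℕ)) => θ ⟨j, k⟩ :
          PiLp p fun _ : Fin (2 ^ (j : ℕ)) => ℝ)‖ : PiLp q fun _ : Fin J => ℝ)‖ ≤ M}

/-- `z_a = Φ⁻¹(1 - a)` with `Φ` the standard normal distribution function. -/
def zQuantile (a : ℝ) : ℝ := sInf {x : ℝ | 1 - a ≤ cdf (gaussianReal 0 1) x}

theorem existsUnique_root : ∃! x : ℝ, 1 < x ∧ x - Real.log x = 5 := by
  have key : ∀ x y : ℝ, 1 < x → x < y → x - Real.log x < y - Real.log y := by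
    intro x y hx hxy
    have hx0 : 0 < x := by linarith
    have h1 : Real.log (y / x) ≤ y / x - 1 :=
      Real.log_le_sub_one_of_pos (div_pos (by linarith) hx0)
    rw [Real.log_div (by linarith) (by linarith)] at h1
    have h2 : y / x - 1 < y - x := by
      rw [div_sub_one (by linarith), div_lt_iff₀ hx0]
      nlinarith
    linarith
  have hcont : ContinuousOn (fun x : ℝ => x - Real.log x) (Set.Icc 1 (Real.exp 3)) :=
    continuousOn_id.sub (Real.continuousOn_log.mono fun x hx => by
      have := hx.1
      simp only [Set.mem_compl_iff, Set.mem_singleton_iff]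
      linarith)
  have h3 : (8 : ℝ) ≤ Real.exp 3 := by
    have h : (2 : ℝ) ≤ Real.exp 1 := by have := Real.add_one_le_exp (1 : ℝ); linarith
    have e : Real.exp 3 = Real.exp 1 ^ 3 := by rw [← Real.exp_nat_mul]; norm_num
    rw [e]
    calc (8 : ℝ) = 2 ^ 3 := by norm_num
      _ ≤ _ := by gcongr
  have hmem : (5 : ℝ) ∈ Set.Icc ((fun x : ℝ => x - Real.log x) 1)
      ((fun x : ℝ => x - Real.log x) (Real.exp 3)) := by
    constructor
    · norm_num
    · simp only [Real.log_exp]; linarith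
  obtain ⟨x, hx, hx5⟩ := intermediate_value_Icc (by linarith) hcont hmem
  have hx5' : x - Real.log x = 5 := hx5
  have hx1 : 1 < x := by
    rcases lt_or_eq_of_le hx.1 with h | h
    · exact h
    · rw [← h] at hx5'; norm_num at hx5'
  refine ⟨x, ⟨hx1, hx5'⟩, ?_⟩
  rintro y ⟨hy1, hy5⟩
  rcases lt_trichotomy x y with h | h | h
  · have := key x y hx1 h; linarith
  · exact h.symm
  · have := key y x hy1 h; linarith

/-- `λ_* = 6.9368...`, the root greater than `1` of `λ - log λ = 5`. -/
def lambdaStar : ℝ := Classical.choose existsUnique_root.exists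

theorem lambdaStar_spec : 1 < lambdaStar ∧ lambdaStar - Real.log lambdaStar = 5 :=
  Classical.choose_spec existsUnique_root.exists

/-- The block length `L`: `log n` rounded up to an integer. -/
def blockLen (n : ℝ) : ℕ := ⌈Real.log n⌉₊

/-- The number of complete blocks of length `L` at level `j`, the integer part of `2 ^ j / L`. -/
def numBlocks (n : ℝ) (j : ℕ) : ℕ := 2 ^ j / blockLen n

/-- `S²_{j,i}`, the sum of the squares of the observations in the `i`-th block of level `j`. -/
def blockSq {J : ℕ} (n : ℝ) (y : Idx J → ℝ) (j : Fin J) (i : ℕ) : ℝ :=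
  ∑ k ∈ (Finset.univ : Finset (Fin (2 ^ (j : ℕ)))).filter
      (fun k : Fin (2 ^ (j : ℕ)) => i * blockLen n ≤ (k : ℕ) ∧ (k : ℕ) < (i + 1) * blockLen n), y ⟨j, k⟩ ^ 2

/-- The threshold `λ_* L / n`. -/
def threshold (n : ℝ) : ℝ := lambdaStar * blockLen n / n

open Classical in
/-- The block thresholding estimator: a coefficient in a complete block is kept if `S²` of its block
reaches the threshold and is set to `0` otherwise. A coefficient in no complete block is kept. -/
def center {J : ℕ} (n : ℝ) (y : Idx J → ℝ) : Idx J → ℝ := fun a =>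
  if (a.2 : ℕ) / blockLen n < numBlocks n a.1 ∧
      blockSq n y a.1 ((a.2 : ℕ) / blockLen n) < threshold n then 0 else y a

/-- `2 λ_* + 8 λ_*^{1/2} - 1`. -/
def keepCost : ℝ := 2 * lambdaStar + 8 * √lambdaStar - 1

/-- `2 log^{1/2}(2/α) + 4 λ_*^{1/2} z_{α/2}`. -/
def baseCost (α : ℝ) : ℝ := 2 * √(Real.log (2 / α)) + 4 * √lambdaStar * zQuantile (α / 2)

open Classical in
/-- The squared radius. In its last term `2 ^ j % L` is the number of coefficients of level `j` that
lie in no complete block; like every kept coefficient, each of them costs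
`(2 λ_* + 8 λ_*^{1/2} - 1) / n`. -/
def radiusSq {J : ℕ} (n α : ℝ) (y : Idx J → ℝ) : ℝ :=
  baseCost α * (√(dim J) / n)
    + ∑ j : Fin J, max 0 (∑ i ∈ Finset.range (numBlocks n j),
        if blockSq n y j i ≤ threshold n then blockSq n y j i - blockLen n / n else 0)
    + keepCost * (blockLen n / n) *
        ∑ j : Fin J, (((Finset.range (numBlocks n j)).filter
          fun i => threshold n < blockSq n y j i).card : ℝ)
    + keepCost / n * ∑ j : Fin J, ((2 ^ (j : ℕ) % blockLen n : ℕ) : ℝ)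

/-- The radius. -/
def radius {J : ℕ} (n α : ℝ) (y : Idx J → ℝ) : ℝ := √(radiusSq n α y)

/-- The confidence ball `{θ : ‖θ - center‖₂ ≤ radius}`. -/
def confBall {J : ℕ} (n α : ℝ) (y : Idx J → ℝ) : Set (Idx J → ℝ) :=
  {θ | √(∑ a, (θ a - center n y a) ^ 2) ≤ radius n α y}

end HonestBall

end

open HonestBall

/-! Put m = √n θ. A block statistic becomes Σ (m + z)² with z standard normal, and n times the
squared loss splits exactly: a killed block loses Σ m², while a kept block or a free coefficient
loses Σ z² (`mul_sum_sq_sub_center`). In a killed block Σ m² = (Σ (m + z)² - L) + (L - Σ z²) - Σ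
2mz, an observable excess plus two centred noise terms.

Coverage. The set of killed blocks is random, so the noise terms are summed over the deterministic
set of small blocks, those with Σ m² ≤ 4λL; off a rare event it contains every killed block. The
price is that a kept small block must pay for noise terms it did not need, and `keepCost` is exactly
what this requires (`block_loss_le`). Over the small blocks, each noise sum exceeds its half of
`baseCost α * √N` with probability at most α/2, by `lower_tail_chiSq` and `tail_linear_quantile`.
The equation λ - log λ = 5 makes each of the two bad events of a block have probability at most
exp(-2L) ≤ n⁻². Together with the free coefficients these failures cost at most 2N/(L n²) ≤ 2/log n.

Expected radius. At level j the positive part has mean at most √(2·2^j) plus a multiple of min(2^j,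
energy of m at level j); the square roots add up to at most 4√N (`integral_level_le`,
`sum_sqrt_level_le`). A block is kept either because its energy is of order L or by an event of
probability at most n^{-(2-δ)} (`integral_kept_le`). On a Besov body with p ≥ 2 the energy of m at
level j is at most M² n 2^{-2τj}. With T = (M² n)^{1/(1+2τ)} the sum of the minima is O(T), and T/n
is the stated rate (`sum_min_level_le`). The free coefficients number O(log² n), which T absorbs. -/

noncomputable section

namespace HonestBall

/-! ### One-dimensional Gaussian integrals: exponential moments of squares, and moments up to order
four -/

section OneDim

/-- Completing the square: tilting the normal density by a quadratic exponential gives a multiple of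
another normal density, so the exponential moment can be read off as the prefactor. -/
theorem exp_sq_mul_gaussianPDFReal {t : ℝ} (ht : t < 1 / 2) (m x : ℝ) :
    gaussianPDFReal 0 1 x * Real.exp (t * (m + x) ^ 2) =
      (√(1 - 2 * t))⁻¹ * Real.exp (t * m ^ 2 / (1 - 2 * t)) *
        gaussianPDFReal (2 * t * m / (1 - 2 * t)) (Real.toNNReal (1 - 2 * t)⁻¹) x := by
  have h : 0 < 1 - 2 * t := by linarith
  have hne := h.ne'
  have hc : ((Real.toNNReal (1 - 2 * t)⁻¹ : NNReal) : ℝ) = (1 - 2 * t)⁻¹ :=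
    Real.coe_toNNReal _ (inv_nonneg.2 h.le)
  simp only [gaussianPDFReal, hc, NNReal.coe_one, mul_one, sub_zero]
  rw [mul_assoc, ← Real.exp_add, Real.sqrt_mul (by positivity) (1 - 2 * t)⁻¹, Real.sqrt_inv,
    mul_inv, inv_inv]
  have hs : √(1 - 2 * t) ≠ 0 := (Real.sqrt_pos.2 h).ne'
  calc _ = (√(2 * Real.pi))⁻¹ * (Real.exp (t * m ^ 2 / (1 - 2 * t)) *
        Real.exp (-(x - 2 * t * m / (1 - 2 * t)) ^ 2 / (2 * (1 - 2 * t)⁻¹))) := by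
        rw [← Real.exp_add]
        congr 2
        field_simp
        ring
    _ = _ := by field_simp

theorem toNNReal_inv_ne_zero {t : ℝ} (ht : t < 1 / 2) : Real.toNNReal (1 - 2 * t)⁻¹ ≠ 0 := by
  have h : 0 < 1 - 2 * t := by linarith
  simpa using h

theorem integrable_exp_sq_gaussianReal {t : ℝ} (ht : t < 1 / 2) (m : ℝ) :
    Integrable (fun x => Real.exp (t * (m + x) ^ 2)) (gaussianReal 0 1) := by
  rw [gaussianReal_of_var_ne_zero 0 one_ne_zero,
    integrable_withDensity_iff_integrable_smul₀' (measurable_gaussianPDF 0 1).aemeasurable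
      (ae_of_all _ fun _ => gaussianPDF_lt_top)]
  simp only [toReal_gaussianPDF, smul_eq_mul, exp_sq_mul_gaussianPDFReal ht]
  exact (integrable_gaussianPDFReal _ _).const_mul _

theorem integral_exp_sq_gaussianReal {t : ℝ} (ht : t < 1 / 2) (m : ℝ) :
    ∫ x, Real.exp (t * (m + x) ^ 2) ∂gaussianReal 0 1 =
      (√(1 - 2 * t))⁻¹ * Real.exp (t * m ^ 2 / (1 - 2 * t)) := by
  rw [integral_gaussianReal_eq_integral_smul one_ne_zero]
  simp only [smul_eq_mul, exp_sq_mul_gaussianPDFReal ht]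
  rw [integral_const_mul, integral_gaussianPDFReal_eq_one _ (toNNReal_inv_ne_zero ht), mul_one]

theorem memLp_pow_gaussianReal (k : ℕ) (p : ℝ≥0∞) (hp : p ≠ ∞) :
    MemLp (fun x : ℝ => x ^ k) p (gaussianReal 0 1) := by
  rcases k.eq_zero_or_pos with rfl | hk
  · simpa using memLp_const (1 : ℝ)
  have h := (memLp_id_gaussianReal' (μ := 0) (v := 1) (p * k)
    (ENNReal.mul_ne_top hp (ENNReal.natCast_ne_top k))).norm_rpow_div (k : ℝ≥0∞)
  have hk0 : (k : ℝ≥0∞) ≠ 0 := by exact_mod_cast hk.ne'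
  rw [ENNReal.mul_div_cancel_right hk0 (ENNReal.natCast_ne_top k)] at h
  refine h.of_le (by fun_prop) (ae_of_all _ fun x => ?_)
  simp

/-- Moments are the derivatives at 0 of the moment generating function. -/
theorem integral_pow_gaussianReal (k : ℕ) :
    ∫ x, x ^ k ∂gaussianReal 0 1 = iteratedDeriv k (fun t => Real.exp (t ^ 2 / 2)) 0 := by
  have h := iteratedDeriv_mgf_zero (X := id) (μ := gaussianReal 0 1) (by simp) k
  simp only [mgf_id_gaussianReal] at h
  simpa using h.symm

theorem integral_pow_three_four_gaussianReal :
    ∫ x, x ^ 3 ∂gaussianReal 0 1 = 0 ∧ ∫ x, x ^ 4 ∂gaussianReal 0 1 = 3 := by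
  have h1 : deriv (fun t : ℝ => Real.exp (t ^ 2 / 2)) = fun t => t * Real.exp (t ^ 2 / 2) := by
    funext t
    have := (((hasDerivAt_id t).pow 2).div_const 2).exp
    simp at this
    rw [this.deriv]; ring
  have h2 : deriv (fun t : ℝ => t * Real.exp (t ^ 2 / 2)) =
      fun t => (1 + t ^ 2) * Real.exp (t ^ 2 / 2) := by
    funext t
    have := (hasDerivAt_id t).mul (((hasDerivAt_id t).pow 2).div_const 2).exp
    simp at this
    rw [show (fun t : ℝ => t * Real.exp (t ^ 2 / 2)) = id * fun x => Real.exp (x ^ 2 / 2) from rfl,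
      this.deriv]; ring
  have h3 : deriv (fun t : ℝ => (1 + t ^ 2) * Real.exp (t ^ 2 / 2)) =
      fun t => (3 * t + t ^ 3) * Real.exp (t ^ 2 / 2) := by
    funext t
    have := (((hasDerivAt_id t).pow 2).const_add 1).mul
      (((hasDerivAt_id t).pow 2).div_const 2).exp
    simp at this
    refine (this.deriv.symm.trans ?_).symm.trans ?_
    · rfl
    · ring
  have h4 : HasDerivAt (fun t : ℝ => (3 * t + t ^ 3) * Real.exp (t ^ 2 / 2)) 3 0 := by
    have := (((hasDerivAt_id (0 : ℝ)).const_mul 3).add ((hasDerivAt_id (0 : ℝ)).pow 3)).mul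
      (((hasDerivAt_id (0 : ℝ)).pow 2).div_const 2).exp
    exact this.congr_deriv (by simp)
  constructor
  · rw [integral_pow_gaussianReal]
    simp only [iteratedDeriv_succ, iteratedDeriv_zero, h1, h2, h3]
    simp
  · rw [integral_pow_gaussianReal]
    simp only [iteratedDeriv_succ, iteratedDeriv_zero, h1, h2, h3]
    exact h4.deriv

theorem integral_sq_gaussianReal : ∫ x, x ^ 2 ∂gaussianReal 0 1 = 1 := by
  have h := variance_fun_id_gaussianReal (μ := 0) (v := 1)
  rw [variance_eq_sub (X := fun x => x) (memLp_id_gaussianReal 2), integral_id_gaussianReal] at h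
  simpa using h

theorem memLp_centered_sq_gaussianReal (m : ℝ) :
    MemLp (fun x : ℝ => (m + x) ^ 2 - 1) 2 (gaussianReal 0 1) := by
  have h : (fun x : ℝ => (m + x) ^ 2 - 1) = fun x => x ^ 2 + (2 * m * x ^ 1 + (m ^ 2 - 1)) := by
    funext x; ring
  rw [h]
  exact (memLp_pow_gaussianReal 2 2 (by simp)).add
    (((memLp_pow_gaussianReal 1 2 (by simp)).const_mul _).add (memLp_const _))

theorem integral_centered_sq_gaussianReal (m : ℝ) :
    ∫ x, ((m + x) ^ 2 - 1) ∂gaussianReal 0 1 = m ^ 2 := by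
  have i1 : Integrable (fun x : ℝ => x ^ 2) (gaussianReal 0 1) :=
    (memLp_pow_gaussianReal 2 1 (by simp)).integrable le_rfl
  have i2 : Integrable (fun x : ℝ => x) (gaussianReal 0 1) := by
    simpa using (memLp_pow_gaussianReal 1 1 (by simp)).integrable le_rfl
  have h : (fun x : ℝ => (m + x) ^ 2 - 1) = fun x => x ^ 2 + (2 * m * x + (m ^ 2 - 1)) := by
    funext x; ring
  have i3 : Integrable (fun x : ℝ => 2 * m * x + (m ^ 2 - 1)) (gaussianReal 0 1) :=
    (i2.const_mul _).add (integrable_const _)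
  rw [h, integral_add i1 i3,
    integral_add (i2.const_mul _) (integrable_const _), integral_const_mul, integral_sq_gaussianReal,
    integral_id_gaussianReal]
  simp

theorem variance_centered_sq_gaussianReal (m : ℝ) :
    Var[fun x : ℝ => (m + x) ^ 2 - 1; gaussianReal 0 1] = 2 + 4 * m ^ 2 := by
  rw [variance_eq_sub (memLp_centered_sq_gaussianReal m), integral_centered_sq_gaussianReal]
  have i : ∀ k, Integrable (fun x : ℝ => x ^ k) (gaussianReal 0 1) := fun k =>
    (memLp_pow_gaussianReal k 1 (by simp)).integrable le_rfl
  have h : ((fun x : ℝ => (m + x) ^ 2 - 1) ^ 2) = fun x =>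
      x ^ 4 + (4 * m * x ^ 3 + ((6 * m ^ 2 - 2) * x ^ 2 +
        ((4 * m ^ 3 - 4 * m) * x ^ 1 + (m ^ 2 - 1) ^ 2))) := by
    funext x; simp only [Pi.pow_apply]; ring
  have j1 := (i 1).const_mul (4 * m ^ 3 - 4 * m)
  have j2 := (i 2).const_mul (6 * m ^ 2 - 2)
  have j3 := (i 3).const_mul (4 * m)
  have j0 : Integrable (fun _ : ℝ => (m ^ 2 - 1) ^ 2) (gaussianReal 0 1) := integrable_const _
  have j1' : Integrable (fun x : ℝ => (4 * m ^ 3 - 4 * m) * x ^ 1 + (m ^ 2 - 1) ^ 2)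
    (gaussianReal 0 1) := j1.add j0
  have j2' : Integrable (fun x : ℝ => (6 * m ^ 2 - 2) * x ^ 2 +
    ((4 * m ^ 3 - 4 * m) * x ^ 1 + (m ^ 2 - 1) ^ 2)) (gaussianReal 0 1) := j2.add j1'
  have j3' : Integrable (fun x : ℝ => 4 * m * x ^ 3 + ((6 * m ^ 2 - 2) * x ^ 2 +
    ((4 * m ^ 3 - 4 * m) * x ^ 1 + (m ^ 2 - 1) ^ 2))) (gaussianReal 0 1) := j3.add j2'
  rw [h, integral_add (i 4) j3', integral_add j3 j2', integral_add j2 j1', integral_add j1 j0]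
  have h1 : ∫ x : ℝ, x ^ 1 ∂gaussianReal 0 1 = 0 := by simp
  simp only [integral_const_mul, integral_pow_three_four_gaussianReal.1,
    integral_pow_three_four_gaussianReal.2, integral_sq_gaussianReal, h1, integral_const]
  simp
  ring

end OneDim

/-! ### Chernoff bounds for sums of independent coordinates -/

section Product

variable {ι : Type*} [Fintype ι]

/-- The standard Gaussian measure on `ι → ℝ`. -/
abbrev stdGauss (ι : Type*) [Fintype ι] : Measure (ι → ℝ) := Measure.pi fun _ => gaussianReal 0 1

/-- Markov's inequality for the exponential of the sum. Coordinates outside `s` contribute the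
factor 1, so Fubini applies on the full product space. The tilt parameter is already part of `f` and
`c`. -/
theorem chernoff_pi (s : Finset ι) (f : ι → ℝ → ℝ) (C : ι → ℝ) (c : ℝ)
    (hf : ∀ i, Integrable (fun x => Real.exp (f i x)) (gaussianReal 0 1))
    (hC : ∀ i, ∫ x, Real.exp (f i x) ∂gaussianReal 0 1 ≤ Real.exp (C i)) :
    (stdGauss ι).real {z | c ≤ ∑ i ∈ s, f i (z i)} ≤ Real.exp (-c + ∑ i ∈ s, C i) := by
  classical
  have e : ∀ z : ι → ℝ, Real.exp (∑ i ∈ s, f i (z i)) =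
      ∏ i, if i ∈ s then Real.exp (f i (z i)) else 1 := by
    intro z
    rw [Real.exp_sum, Finset.prod_ite_mem, Finset.univ_inter]
  have hint : ∀ i, Integrable (fun x => if i ∈ s then Real.exp (f i x) else 1)
      (gaussianReal 0 1) := by
    intro i
    split_ifs
    · exact hf i
    · exact integrable_const _
  have hI : Integrable (fun z : ι → ℝ => Real.exp (1 * ∑ i ∈ s, f i (z i))) (stdGauss ι) := by
    simp only [one_mul, e]
    exact Integrable.fintype_prod (f := fun i x => if i ∈ s then Real.exp (f i x) else 1) hint
  refine (measure_ge_le_exp_mul_mgf c zero_le_one hI).trans ?_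
  rw [Real.exp_add]
  simp only [mgf, neg_mul, one_mul, e]
  refine mul_le_mul_of_nonneg_left ?_ (Real.exp_nonneg _)
  rw [integral_fintype_prod_eq_prod (fun i x => if i ∈ s then Real.exp (f i x) else 1),
    Real.exp_sum]
  rw [← Finset.univ_inter s, ← Finset.prod_ite_mem]
  refine Finset.prod_le_prod (fun i _ => integral_nonneg fun x => ?_) fun i _ => ?_
  · dsimp only; split_ifs <;> positivity
  · simp only [Finset.univ_inter]
    split_ifs
    · exact hC i
    · simp

/-- Upper tail of a noncentral chi-square sum. -/
theorem tail_noncentral_chiSq (s : Finset ι) (m : ι → ℝ) {l : ℝ} (hl : 1 < l) :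
    (stdGauss ι).real {z | l * s.card ≤ ∑ i ∈ s, (m i + z i) ^ 2} ≤
      Real.exp (-(s.card / 2 * (l - 1 - Real.log l)) + (l - 1) / 2 * ∑ i ∈ s, m i ^ 2) := by
  -- The optimal tilt for the central chi-square at level `l`: it gives 1 - 2t = 1/l.
  set t : ℝ := (1 - l⁻¹) / 2 with ht
  have hl0 : 0 < l := by linarith
  have hli : l⁻¹ < 1 := inv_lt_one_of_one_lt₀ hl
  have hli0 : 0 < l⁻¹ := inv_pos.2 hl0
  have ht2 : t < 1 / 2 := by rw [ht]; linarith
  have ht0 : 0 < t := by rw [ht]; linarith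
  have e1 : 1 - 2 * t = l⁻¹ := by rw [ht]; ring
  have h := chernoff_pi s (fun i x => t * (m i + x) ^ 2)
    (fun i => Real.log l / 2 + (l - 1) / 2 * m i ^ 2) (t * (l * s.card))
    (fun i => integrable_exp_sq_gaussianReal ht2 (m i)) (fun i => by
      rw [integral_exp_sq_gaussianReal ht2, Real.exp_add, e1, Real.sqrt_inv, inv_inv]
      refine mul_le_mul (le_of_eq ?_) (le_of_eq ?_) (Real.exp_nonneg _) (Real.exp_nonneg _)
      · rw [Real.sqrt_eq_rpow, Real.rpow_def_of_pos hl0]; ring_nf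
      · congr 1; rw [ht]; field_simp)
  have hset : {z : ι → ℝ | l * s.card ≤ ∑ i ∈ s, (m i + z i) ^ 2} =
      {z | t * (l * s.card) ≤ ∑ i ∈ s, t * (m i + z i) ^ 2} := by
    ext z
    simp only [Set.mem_ofPred_eq, ← Finset.mul_sum]
    exact (mul_le_mul_iff_right₀ ht0).symm
  rw [hset]
  refine h.trans (le_of_eq ?_)
  congr 1
  rw [Finset.sum_add_distrib, Finset.sum_const, nsmul_eq_mul, ← Finset.mul_sum, ht]
  field_simp
  ring

/-- A crude upper tail of a chi-square sum. -/
theorem tail_chiSq_large (s : Finset ι) {k : ℝ} (hk : 25 ≤ k) :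
    (stdGauss ι).real {z | k * s.card ≤ ∑ i ∈ s, z i ^ 2} ≤ Real.exp (-(4 * s.card)) := by
  -- At tilt 1/4 the exponential moment is √2 ≤ e, so each coordinate contributes at most 1 - k/4 ≤
  -- -21/4 to the exponent.
  have h := chernoff_pi s (fun i x => 1 / 4 * (0 + x) ^ 2)
    (fun _ => 1) (1 / 4 * (k * s.card))
    (fun i => integrable_exp_sq_gaussianReal (by norm_num) 0) (fun i => by
      rw [integral_exp_sq_gaussianReal (by norm_num)]
      have h2 : (√(1 - 2 * (1 / 4 : ℝ)))⁻¹ ≤ 2 := by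
        rw [← Real.sqrt_inv]
        exact Real.sqrt_le_iff.2 ⟨by norm_num, by norm_num⟩
      have h3 : (2 : ℝ) ≤ Real.exp 1 := by have := Real.add_one_le_exp (1 : ℝ); linarith
      simpa using h2.trans h3)
  simp only [zero_add, ← Finset.mul_sum] at h
  refine (le_of_eq ?_).trans (h.trans ?_)
  · congr 1
    ext z
    simp only [Set.mem_ofPred_eq]
    exact (mul_le_mul_iff_right₀ (by norm_num)).symm
  · rw [Real.exp_le_exp, Finset.sum_const, nsmul_eq_mul]
    have : (0 : ℝ) ≤ s.card := Nat.cast_nonneg _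
    nlinarith

theorem sub_sq_div_two_le_log {u : ℝ} (hu : 0 ≤ u) : u - u ^ 2 / 2 ≤ Real.log (1 + u) := by
  have h1 := Real.le_log_one_add_of_nonneg hu
  refine le_trans ?_ h1
  rw [le_div_iff₀ (by linarith)]
  nlinarith [pow_nonneg hu 3]

/-- Lower tail of a chi-square sum. -/
theorem lower_tail_chiSq (s : Finset ι) {N c : ℝ} (hN : 0 < N) (hs : s.card ≤ N) (hc : 0 ≤ c) :
    (stdGauss ι).real {z | c ≤ ∑ i ∈ s, (1 - z i ^ 2)} ≤ Real.exp (-(c ^ 2 / (4 * N))) := by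
  rcases hc.eq_or_lt with rfl | hc
  · simp
  -- The minimiser of -tc + N t². The bound exp(t²) for the moment of exp(t(1 - z²)) comes from
  -- log(1 + u) ≥ u - u²/2 at u = 2t and holds for every t > 0, so the lower tail is sub-Gaussian at
  -- all scales.
  set t : ℝ := c / (2 * N) with ht
  have ht0 : 0 < t := by positivity
  have h := chernoff_pi s (fun i x => t + (-t) * (0 + x) ^ 2)
    (fun _ => t ^ 2) (t * c)
    (fun i => by
      simp only [Real.exp_add]
      exact (integrable_exp_sq_gaussianReal (by linarith) 0).const_mul _) (fun i => by
      simp only [Real.exp_add]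
      rw [integral_const_mul, integral_exp_sq_gaussianReal (by linarith), ← Real.sqrt_inv,
        Real.sqrt_eq_rpow, Real.rpow_def_of_pos (inv_pos.2 (by linarith)), Real.log_inv,
        ← Real.exp_add, ← Real.exp_add, Real.exp_le_exp]
      have := sub_sq_div_two_le_log (u := 2 * t) (by linarith)
      have e : 1 - 2 * -t = 1 + 2 * t := by ring
      rw [e]
      simp
      nlinarith)
  have hset : {z : ι → ℝ | c ≤ ∑ i ∈ s, (1 - z i ^ 2)} =
      {z | t * c ≤ ∑ i ∈ s, (t + (-t) * (0 + z i) ^ 2)} := by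
    ext z
    have : ∑ i ∈ s, (t + (-t) * (0 + z i) ^ 2) = t * ∑ i ∈ s, (1 - z i ^ 2) := by
      rw [Finset.mul_sum]; exact Finset.sum_congr rfl fun i _ => by ring
    simp only [Set.mem_ofPred_eq, this]
    exact (mul_le_mul_iff_right₀ ht0).symm
  rw [hset]
  refine h.trans (Real.exp_le_exp.2 ?_)
  rw [Finset.sum_const, nsmul_eq_mul]
  have h1 : s.card * t ^ 2 ≤ N * t ^ 2 := by gcongr
  have h2 : -(t * c) + N * t ^ 2 = -(c ^ 2 / (4 * N)) := by rw [ht]; field_simp; ring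
  linarith

theorem integral_exp_mul_gaussianReal (a : ℝ) :
    ∫ x, Real.exp (a * x) ∂gaussianReal 0 1 = Real.exp (a ^ 2 / 2) := by
  have := congrFun (mgf_id_gaussianReal (μ := 0) (v := 1)) a
  simpa [mgf] using this

/-- Upper tail of a Gaussian linear form. -/
theorem tail_linear (s : Finset ι) (a : ι → ℝ) (c : ℝ) {t : ℝ} (ht : 0 < t) :
    (stdGauss ι).real {z | c ≤ ∑ i ∈ s, a i * z i} ≤
      Real.exp (-(t * c) + t ^ 2 / 2 * ∑ i ∈ s, a i ^ 2) := by
  have h := chernoff_pi s (fun i x => (t * a i) * x) (fun i => (t * a i) ^ 2 / 2) (t * c)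
    (fun i => integrable_exp_mul_gaussianReal _) (fun i => (integral_exp_mul_gaussianReal _).le)
  have hset : {z : ι → ℝ | c ≤ ∑ i ∈ s, a i * z i} =
      {z | t * c ≤ ∑ i ∈ s, t * a i * z i} := by
    ext z
    simp only [Set.mem_ofPred_eq, mul_assoc, ← Finset.mul_sum]
    exact (mul_le_mul_iff_right₀ ht).symm
  rw [hset]
  refine h.trans (le_of_eq ?_)
  congr 2
  rw [Finset.mul_sum]
  exact Finset.sum_congr rfl fun i _ => by ring

/-- The characteristic function factors over the coordinates. The exact law is needed, because the
radius uses the normal quantile and not a Chernoff bound. -/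
theorem map_linear_stdGauss (a : ι → ℝ) :
    (stdGauss ι).map (fun z => ∑ i, a i * z i) =
      gaussianReal 0 (Real.toNNReal (∑ i, a i ^ 2)) := by
  refine Measure.ext_of_charFun ?_
  funext t
  rw [charFun_apply_real, integral_map (Measurable.aemeasurable (by fun_prop)) (by fun_prop), charFun_gaussianReal,
    Real.coe_toNNReal _ (Finset.sum_nonneg fun i _ => sq_nonneg (a i))]
  have e : ∀ z : ι → ℝ, Complex.exp (t * ((∑ i, a i * z i : ℝ) : ℂ) * Complex.I) =
      ∏ i, Complex.exp (((t * a i : ℝ) : ℂ) * (z i : ℂ) * Complex.I) := by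
    intro z
    rw [← Complex.exp_sum]
    congr 1
    push_cast
    rw [Finset.mul_sum, Finset.sum_mul]
    exact Finset.sum_congr rfl fun i _ => by ring
  simp only [e]
  rw [integral_fintype_prod_eq_prod
    (fun i (x : ℝ) => Complex.exp (((t * a i : ℝ) : ℂ) * (x : ℂ) * Complex.I))]
  simp only [← charFun_apply_real, charFun_gaussianReal]
  rw [← Complex.exp_sum]
  congr 1
  push_cast
  simp only [mul_zero, zero_mul, zero_sub, Finset.sum_neg_distrib, one_mul]
  rw [Finset.sum_mul, Finset.sum_div]
  congr 1
  exact Finset.sum_congr rfl fun i _ => by ring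

end Product

/-! ### The normal quantile -/

section Quantile

theorem gaussianReal_Iio_zero_le : (gaussianReal 0 1).real (Set.Iio 0) ≤ 1 / 2 := by
  have h : (gaussianReal 0 1).real (Set.Iio 0) = (gaussianReal 0 1).real (Set.Ioi 0) := by
    have h1 := gaussianReal_map_neg (μ := 0) (v := 1)
    rw [neg_zero] at h1
    conv_lhs => rw [← h1]
    rw [map_measureReal_apply (by fun_prop) measurableSet_Iio]
    congr 1
    ext x; simp
  have h2 : (gaussianReal 0 1).real (Set.Iio 0) + (gaussianReal 0 1).real (Set.Ioi 0) ≤ 1 := by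
    rw [← measureReal_union (by
      rw [Set.disjoint_left]; intro x (hx : x < 0) (hx' : 0 < x); exact lt_asymm hx hx') measurableSet_Ioi]
    exact measureReal_le_one
  linarith

/-- Right continuity of the distribution function puts the infimum in the set. Negative points are
excluded since P(Z < 0) ≤ 1/2 < 1 - a. -/
theorem zQuantile_spec {a : ℝ} (ha : 0 < a) (ha2 : a < 1 / 2) :
    0 ≤ zQuantile a ∧ (gaussianReal 0 1).real (Set.Ioi (zQuantile a)) ≤ a := by
  set S : Set ℝ := {x : ℝ | 1 - a ≤ cdf (gaussianReal 0 1) x} with hS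
  have hne : S.Nonempty := by
    have h := (tendsto_cdf_atTop (gaussianReal 0 1)).eventually (lt_mem_nhds (show 1 - a < 1 by linarith))
    obtain ⟨x, hx⟩ := h.exists
    exact ⟨x, hx.le⟩
  have hpos : ∀ x ∈ S, 0 ≤ x := by
    intro x hx
    by_contra hneg
    push Not at hneg
    have h1 : cdf (gaussianReal 0 1) x ≤ (gaussianReal 0 1).real (Set.Iio 0) := by
      rw [cdf_eq_real]
      exact measureReal_mono fun y hy => lt_of_le_of_lt hy hneg
    have h2 : 1 - a ≤ cdf (gaussianReal 0 1) x := hx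
    have := gaussianReal_Iio_zero_le
    linarith
  have hbdd : BddBelow S := ⟨0, hpos⟩
  refine ⟨le_csInf hne hpos, ?_⟩
  have hmem : 1 - a ≤ cdf (gaussianReal 0 1) (zQuantile a) := by
    have hc := ((cdf (gaussianReal 0 1)).right_continuous (zQuantile a)).mono Set.Ioi_subset_Ici_self
    refine ge_of_tendsto hc ?_
    filter_upwards [self_mem_nhdsWithin] with x hx
    obtain ⟨y, hy, hyx⟩ := exists_lt_of_csInf_lt hne hx
    exact le_trans hy (monotone_cdf _ hyx.le)
  rw [cdf_eq_real] at hmem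
  have := measureReal_compl (μ := gaussianReal 0 1) (measurableSet_Iic (a := zQuantile a))
  rw [Set.compl_Iic] at this
  rw [this]
  simp only [probReal_univ]
  linarith

end Quantile

/-! ### Gaussian linear forms, absence of ties, and the mean of a positive part -/

section ProductLaws

variable {ι : Type*} [Fintype ι]

/-- The form has the law of ρZ with ρ ≤ σ. An upper bound σ for the standard deviation is enough
because the quantile is nonnegative. -/
theorem tail_linear_quantile (a : ι → ℝ) {σ p : ℝ} (hp : 0 < p) (hp2 : p < 1 / 2) (hσ : 0 < σ)
    (h : ∑ i, a i ^ 2 ≤ σ ^ 2) :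
    (stdGauss ι).real {z | σ * zQuantile p < ∑ i, a i * z i} ≤ p := by
  obtain ⟨hz, hq⟩ := zQuantile_spec hp hp2
  have hS0 : 0 ≤ ∑ i, a i ^ 2 := Finset.sum_nonneg fun i _ => sq_nonneg (a i)
  have e : {z : ι → ℝ | σ * zQuantile p < ∑ i, a i * z i} =
      (fun z : ι → ℝ => ∑ i, a i * z i) ⁻¹' Set.Ioi (σ * zQuantile p) := rfl
  rw [e, ← map_measureReal_apply (by fun_prop) measurableSet_Ioi, map_linear_stdGauss]
  set ρ := √(∑ i, a i ^ 2) with hρ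
  have hρσ : ρ ≤ σ := Real.sqrt_le_iff.2 ⟨hσ.le, h⟩
  have hρ0 : 0 ≤ ρ := Real.sqrt_nonneg _
  have hmap := gaussianReal_map_const_mul (μ := 0) (v := 1) ρ
  have hv : NNReal.mk (ρ ^ 2) (sq_nonneg ρ) * 1 = Real.toNNReal (∑ i, a i ^ 2) := by
    ext
    rw [Real.coe_toNNReal _ hS0, mul_one, NNReal.coe_mk, hρ, Real.sq_sqrt hS0]
  rw [mul_zero, hv] at hmap
  rw [← hmap]
  rw [map_measureReal_apply (by fun_prop) measurableSet_Ioi]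
  refine le_trans (measureReal_mono fun x hx => ?_) hq
  simp only [Set.mem_preimage, Set.mem_Ioi] at hx ⊢
  by_contra hneg
  push Not at hneg
  have h1 : ρ * x ≤ ρ * zQuantile p := mul_le_mul_of_nonneg_left hneg hρ0
  have h2 : ρ * zQuantile p ≤ σ * zQuantile p := mul_le_mul_of_nonneg_right hρσ hz
  linarith

/-- Once all coordinates but one are fixed, the last one can take at most two values. This removes
ties at the threshold, where the estimator keeps a block but the radius treats it as killed. -/
theorem measure_noncentral_chiSq_eq (s : Finset ι) (hs : s.Nonempty) (m : ι → ℝ) (c : ℝ) :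
    stdGauss ι {z | ∑ i ∈ s, (m i + z i) ^ 2 = c} = 0 := by
  classical
  obtain ⟨i₀, hi₀⟩ := hs
  have hind : iIndepFun (fun i (z : ι → ℝ) => (m i + z i) ^ 2) (stdGauss ι) :=
    iIndepFun_pi (X := fun i x => (m i + x) ^ 2) fun i => by fun_prop
  have h1 := hind.indepFun_finsetSum_of_notMem (fun i => by fun_prop)
    (s := s.erase i₀) (i := i₀) (by simp)
  set X : (ι → ℝ) → ℝ := ∑ j ∈ s.erase i₀, fun z : ι → ℝ => (m j + z j) ^ 2 with hX
  set Y : (ι → ℝ) → ℝ := fun z => (m i₀ + z i₀) ^ 2 with hY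
  have hXm : Measurable X := by
    rw [hX]; fun_prop
  have hYm : Measurable Y := by rw [hY]; fun_prop
  have h2 := (indepFun_iff_map_prod_eq_prod_map_map hXm.aemeasurable hYm.aemeasurable).1 h1
  have hset : {z : ι → ℝ | ∑ i ∈ s, (m i + z i) ^ 2 = c} =
      (fun z => (X z, Y z)) ⁻¹' {p : ℝ × ℝ | p.1 + p.2 = c} := by
    ext z
    simp only [Set.mem_ofPred_eq, Set.mem_preimage, hX, hY, Finset.sum_apply]
    rw [Finset.sum_erase_add _ _ hi₀]
  have hmeas : MeasurableSet {p : ℝ × ℝ | p.1 + p.2 = c} :=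
    measurableSet_eq_fun (by fun_prop) (by fun_prop)
  rw [hset, ← Measure.map_apply (hXm.prodMk hYm) hmeas, h2, Measure.prod_apply hmeas]
  refine (lintegral_congr fun x => ?_).trans lintegral_zero
  rw [Measure.map_apply hYm (by exact measurableSet_eq_fun (by fun_prop) (by fun_prop))]
  have := nullSingletonClass_gaussianReal (μ := 0) (v := 1) one_ne_zero
  have h3 : (Y ⁻¹' (Prod.mk x ⁻¹' {p : ℝ × ℝ | p.1 + p.2 = c})) ⊆
      Function.eval i₀ ⁻¹' {√(c - x) - m i₀, -√(c - x) - m i₀} := by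
    intro z hz
    simp only [Set.mem_preimage, Set.mem_ofPred_eq, hY] at hz
    have h4 : (m i₀ + z i₀) ^ 2 = (√(c - x)) ^ 2 := by
      rw [Real.sq_sqrt (by nlinarith [sq_nonneg (m i₀ + z i₀)])]; linarith
    rcases sq_eq_sq_iff_eq_or_eq_neg.1 h4 with h5 | h5
    · left; simp only [Function.eval]; linarith
    · right; simp only [Function.eval, Set.mem_singleton_iff]; linarith
  refine measure_mono_null h3 ?_
  rw [(measurePreserving_eval (fun _ : ι => gaussianReal 0 1) i₀).measure_preimage
    (Set.toFinite _).measurableSet.nullMeasurableSet]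
  exact (Set.toFinite _).measure_zero _

/-- Expected positive part of a centred noncentral chi-square sum. -/
theorem integral_pos_part_centered_le (s : Finset ι) (m : ι → ℝ) :
    Integrable (fun z => max 0 (∑ i ∈ s, ((m i + z i) ^ 2 - 1))) (stdGauss ι) ∧
    ∫ z, max 0 (∑ i ∈ s, ((m i + z i) ^ 2 - 1)) ∂stdGauss ι ≤
      ∑ i ∈ s, m i ^ 2 + √(2 * s.card + 4 * ∑ i ∈ s, m i ^ 2) := by
  classical
  set X : ι → ℝ → ℝ := fun i => if i ∈ s then fun x => (m i + x) ^ 2 - 1 else fun _ => 0 with hX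
  have hXL : ∀ i, MemLp (X i) 2 (gaussianReal 0 1) := by
    intro i
    simp only [hX]
    split_ifs
    · exact memLp_centered_sq_gaussianReal _
    · exact memLp_const _
  have hXs : (∑ i, fun z : ι → ℝ => X i (z i)) = fun z => ∑ i ∈ s, ((m i + z i) ^ 2 - 1) := by
    funext z
    rw [Finset.sum_apply]
    simp only [hX]
    rw [← Finset.univ_inter s, ← Finset.sum_ite_mem, Finset.univ_inter]
    refine Finset.sum_congr rfl fun i _ => ?_
    split_ifs <;> rfl
  set W : (ι → ℝ) → ℝ := fun z => ∑ i ∈ s, ((m i + z i) ^ 2 - 1) with hW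
  have hXe : ∀ i, MemLp (fun z : ι → ℝ => X i (z i)) 2 (stdGauss ι) := fun i =>
    (hXL i).comp_measurePreserving (measurePreserving_eval (fun _ : ι => gaussianReal 0 1) i)
  have hWL : MemLp W 2 (stdGauss ι) := by
    rw [← hXs]
    exact memLp_finsetSum' _ fun i _ => hXe i
  have hWi : Integrable W (stdGauss ι) := hWL.integrable (by norm_num)
  have hvar : Var[W; stdGauss ι] = 2 * s.card + 4 * ∑ i ∈ s, m i ^ 2 := by
    rw [← hXs, variance_sum_pi hXL]
    have : ∀ i, Var[X i; gaussianReal 0 1] = if i ∈ s then 2 + 4 * m i ^ 2 else 0 := by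
      intro i
      simp only [hX]
      split_ifs
      · exact variance_centered_sq_gaussianReal _
      · exact variance_zero _
    simp only [this]
    rw [Finset.sum_ite_mem, Finset.univ_inter, Finset.sum_add_distrib, ← Finset.mul_sum,
      Finset.sum_const, nsmul_eq_mul]
    ring
  have hmean : ∫ z, W z ∂stdGauss ι = ∑ i ∈ s, m i ^ 2 := by
    rw [hW, integral_finsetSum]
    · refine Finset.sum_congr rfl fun i _ => ?_
      rw [integral_comp_eval (μ := fun _ : ι => gaussianReal 0 1) (i := i)
        (f := fun x : ℝ => (m i + x) ^ 2 - 1) (by fun_prop)]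
      exact integral_centered_sq_gaussianReal _
    · intro i _
      exact integrable_comp_eval (μ := fun _ : ι => gaussianReal 0 1) (i := i)
        (f := fun x : ℝ => (m i + x) ^ 2 - 1)
        ((memLp_centered_sq_gaussianReal _).integrable (by norm_num))
  set A := ∑ i ∈ s, m i ^ 2 with hA
  have hA0 : 0 ≤ A := Finset.sum_nonneg fun i _ => sq_nonneg _
  set V := 2 * (s.card : ℝ) + 4 * A with hV
  have hV0 : 0 ≤ V := by positivity
  have hint : Integrable (fun z => max 0 (W z)) (stdGauss ι) := (integrable_zero _ _ _).sup hWi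
  refine ⟨hint, ?_⟩
  have hsq : Integrable (fun z => (W z - A) ^ 2) (stdGauss ι) :=
    (hWL.sub (memLp_const A)).integrable_sq
  have hvar2 : ∫ z, (W z - A) ^ 2 ∂stdGauss ι = V := by
    rw [variance_eq_integral hWL.1.aemeasurable, hmean] at hvar
    exact hvar
  rcases hV0.eq_or_lt with h0 | hVpos
  · have hcard : s.card = 0 := by
      have h1 : (0 : ℝ) ≤ s.card := Nat.cast_nonneg _
      have : (s.card : ℝ) = 0 := by linarith
      exact_mod_cast this
    have hs : s = ∅ := Finset.card_eq_zero.1 hcard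
    subst hs
    simp [hA, hV]
  · set r := √V with hr
    have hr0 : 0 < r := Real.sqrt_pos.2 hVpos
    -- AM-GM in place of Cauchy–Schwarz: since r is the standard deviation of W, the bracket
    -- integrates to r/2 + r/2 = r.
    have hpt : ∀ z, max 0 (W z) ≤ A + ((W z - A) ^ 2 * (2 * r)⁻¹ + r / 2) := by
      intro z
      have h1 : W z - A ≤ (W z - A) ^ 2 * (2 * r)⁻¹ + r / 2 := by
        have : 0 ≤ (W z - A - r) ^ 2 * (2 * r)⁻¹ := by positivity
        have e : (W z - A - r) ^ 2 * (2 * r)⁻¹ =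
          (W z - A) ^ 2 * (2 * r)⁻¹ + r / 2 - (W z - A) := by field_simp; ring
        linarith
      refine max_le (by positivity) (by linarith)
    have i2 : Integrable (fun z => (W z - A) ^ 2 * (2 * r)⁻¹ + r / 2) (stdGauss ι) :=
      (hsq.mul_const _).add (integrable_const _)
    refine (integral_mono hint ((integrable_const A).add i2) hpt).trans (le_of_eq ?_)
    have e1 := integral_add (integrable_const A) i2
    simp only [Pi.add_apply]
    rw [e1, integral_add (hsq.mul_const _) (integrable_const _),
      integral_mul_const, hvar2]
    have hrr : V = r ^ 2 := (Real.sq_sqrt hV0).symm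
    simp only [integral_const, probReal_univ, smul_eq_mul, one_mul]
    rw [hrr]
    field_simp
    ring

end ProductLaws

/-! ### The partition into blocks, and the loss and radius after rescaling -/

section Blocks

/-- The pairs `(j, i)` that index the complete blocks. -/
abbrev BlockIdx (n : ℝ) (J : ℕ) : Type := Σ j : Fin J, Fin (numBlocks n j)

/-- The coefficients in a complete block. -/
def block {n : ℝ} {J : ℕ} (b : BlockIdx n J) : Finset (Idx J) :=
  ((Finset.univ : Finset (Fin (2 ^ (b.1 : ℕ)))).filter
    (fun k : Fin (2 ^ (b.1 : ℕ)) => (b.2 : ℕ) * blockLen n ≤ (k : ℕ) ∧ (k : ℕ) < ((b.2 : ℕ) + 1) * blockLen n)).map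
    (Function.Embedding.sigmaMk b.1)

/-- The coefficients in no complete block. -/
def freeIdx (n : ℝ) (J : ℕ) : Finset (Idx J) :=
  Finset.univ.filter fun a => numBlocks n a.1 ≤ (a.2 : ℕ) / blockLen n

variable {n : ℝ} {J : ℕ}

theorem blockLen_pos (hn : 1 < n) : 0 < blockLen n := Nat.ceil_pos.2 (Real.log_pos hn)

theorem log_le_blockLen (n : ℝ) : Real.log n ≤ blockLen n := Nat.le_ceil _

theorem le_exp_blockLen (hn : 1 < n) : n ≤ Real.exp (blockLen n) := by
  rw [← Real.log_le_iff_le_exp (by linarith)]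
  exact log_le_blockLen n

theorem mem_block (hn : 1 < n) (b : BlockIdx n J) (a : Idx J) :
    a ∈ block b ↔ a.1 = b.1 ∧ (a.2 : ℕ) / blockLen n = b.2 := by
  have hL := blockLen_pos hn
  obtain ⟨j, k⟩ := a
  obtain ⟨j', i⟩ := b
  simp only [block, Finset.mem_map, Finset.mem_filter, Finset.mem_univ, true_and,
    Function.Embedding.sigmaMk_apply]
  constructor
  · rintro ⟨k', ⟨h1, h2⟩, he⟩
    obtain ⟨rfl, he⟩ := Sigma.mk.inj_iff.1 he
    obtain rfl := eq_of_heq he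
    exact ⟨rfl, Nat.div_eq_of_lt_le h1 h2⟩
  · rintro ⟨rfl, h⟩
    refine ⟨k, ?_, rfl⟩
    rw [← h]
    exact ⟨Nat.div_mul_le_self _ _, Nat.lt_mul_of_div_lt (Nat.lt_succ_self _) hL⟩

theorem disjoint_block (hn : 1 < n) {b b' : BlockIdx n J} (hbb : b ≠ b') :
    Disjoint (block b) (block b') := by
  refine Finset.disjoint_left.2 fun a ha ha' => hbb ?_
  obtain ⟨h1, h2⟩ := (mem_block hn _ _).1 ha
  obtain ⟨h3, h4⟩ := (mem_block hn _ _).1 ha'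
  obtain ⟨j, i⟩ := b
  obtain ⟨j', i'⟩ := b'
  dsimp only at h1 h2 h3 h4
  subst h1
  subst h3
  congr 1
  exact Fin.ext (h2.symm.trans h4)

/-- A complete block ends within its level, so the filter on `Fin (2 ^ j)` cuts nothing off. -/
theorem card_block (b : BlockIdx n J) : (block b).card = blockLen n := by
  have hb : ((b.2 : ℕ) + 1) * blockLen n ≤ 2 ^ (b.1 : ℕ) :=
    (Nat.mul_le_mul_right _ b.2.2).trans (Nat.div_mul_le_self _ _)
  rw [block, Finset.card_map, ← Finset.card_map Fin.valEmbedding]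
  have : ((Finset.univ : Finset (Fin (2 ^ (b.1 : ℕ)))).filter
    (fun k : Fin (2 ^ (b.1 : ℕ)) => (b.2 : ℕ) * blockLen n ≤ (k : ℕ) ∧ (k : ℕ) < ((b.2 : ℕ) + 1) * blockLen n)).map
    Fin.valEmbedding = Finset.Ico ((b.2 : ℕ) * blockLen n) (((b.2 : ℕ) + 1) * blockLen n) := by
    ext k
    simp only [Finset.mem_map, Finset.mem_filter, Finset.mem_univ, true_and,
      Fin.valEmbedding_apply, Finset.mem_Ico]
    constructor
    · rintro ⟨k, h, rfl⟩; exact h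
    · intro h; exact ⟨⟨k, h.2.trans_le hb⟩, h, rfl⟩
  rw [this, Nat.card_Ico, add_mul, one_mul, Nat.add_sub_cancel_left]

theorem sum_block_eq (b : BlockIdx n J) (f : Idx J → ℝ) :
    ∑ a ∈ block b, f a = ∑ k ∈ (Finset.univ : Finset (Fin (2 ^ (b.1 : ℕ)))).filter
      (fun k : Fin (2 ^ (b.1 : ℕ)) => (b.2 : ℕ) * blockLen n ≤ (k : ℕ) ∧ (k : ℕ) < ((b.2 : ℕ) + 1) * blockLen n),
      f ⟨b.1, k⟩ := by
  rw [block, Finset.sum_map]; rfl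

theorem sum_eq_blocks_add_free (hn : 1 < n) (f : Idx J → ℝ) :
    ∑ a, f a = ∑ b : BlockIdx n J, ∑ a ∈ block b, f a + ∑ a ∈ freeIdx n J, f a := by
  have h1 : ∑ b : BlockIdx n J, ∑ a ∈ block b, f a =
      ∑ a, if (a.2 : ℕ) / blockLen n < numBlocks n a.1 then f a else 0 := by
    have : ∀ b : BlockIdx n J, ∑ a ∈ block b, f a = ∑ a, if a ∈ block b then f a else 0 := by
      intro b; rw [Finset.sum_ite_mem, Finset.univ_inter]
    simp only [this]
    rw [Finset.sum_comm]
    refine Finset.sum_congr rfl fun a _ => ?_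
    split_ifs with h
    · rw [Finset.sum_eq_single (⟨a.1, ⟨_, h⟩⟩ : BlockIdx n J)]
      · rw [if_pos ((mem_block hn _ _).2 ⟨rfl, rfl⟩)]
      · rintro ⟨j, i⟩ _ hb
        refine if_neg fun hmem => hb ?_
        obtain ⟨h2, h3⟩ := (mem_block hn _ _).1 hmem
        dsimp only at h2 h3
        subst h2
        congr 1
        exact Fin.ext h3.symm
      · simp
    · refine Finset.sum_eq_zero fun b _ => if_neg fun hmem => h ?_
      obtain ⟨h2, h3⟩ := (mem_block hn _ _).1 hmem
      rw [h3, congrArg (fun j : Fin J => numBlocks n j) h2]; exact b.2.2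
  rw [h1, freeIdx, Finset.sum_filter, ← Finset.sum_add_distrib]
  refine Finset.sum_congr rfl fun a _ => ?_
  by_cases h : (a.2 : ℕ) / blockLen n < numBlocks n a.1
  · rw [if_pos h, if_neg (not_le.2 h), add_zero]
  · rw [if_neg h, if_pos (not_lt.1 h), zero_add]

theorem sum_levels_eq_sum_blockIdx (g : Fin J → ℕ → ℝ) :
    ∑ j : Fin J, ∑ i ∈ Finset.range (numBlocks n j), g j i = ∑ b : BlockIdx n J, g b.1 b.2 := by
  rw [Fintype.sum_sigma]
  exact Finset.sum_congr rfl fun j _ => (Fin.sum_univ_eq_sum_range (g j) _).symm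

theorem dim_eq_sum (J : ℕ) : dim J = ∑ j : Fin J, (2 : ℝ) ^ (j : ℕ) := by
  rw [Fin.sum_univ_eq_sum_range (fun j => (2 : ℝ) ^ j), geom_sum_eq (by norm_num), dim]
  norm_num

theorem dim_eq_card (J : ℕ) : dim J = Fintype.card (Idx J) := by
  rw [dim_eq_sum, Fintype.card_sigma]
  push_cast
  simp

theorem dim_nonneg (J : ℕ) : 0 ≤ dim J := by rw [dim_eq_card]; exact Nat.cast_nonneg _

theorem dim_eq_blocks_add_free (hn : 1 < n) :
    dim J = Fintype.card (BlockIdx n J) * blockLen n + (freeIdx n J).card := by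
  have h := sum_eq_blocks_add_free (J := J) hn (fun _ => 1)
  simp only [Finset.sum_const, nsmul_eq_mul, mul_one, card_block, Finset.card_univ] at h
  rw [dim_eq_card, h]

theorem card_freeIdx (hn : 1 < n) :
    ((freeIdx n J).card : ℝ) = ∑ j : Fin J, ((2 ^ (j : ℕ) % blockLen n : ℕ) : ℝ) := by
  have h1 := dim_eq_blocks_add_free (J := J) hn
  have h2 : dim J = Fintype.card (BlockIdx n J) * blockLen n +
      ∑ j : Fin J, ((2 ^ (j : ℕ) % blockLen n : ℕ) : ℝ) := by
    rw [dim_eq_sum, Fintype.card_sigma]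
    push_cast
    rw [Finset.sum_mul, ← Finset.sum_add_distrib]
    refine Finset.sum_congr rfl fun j _ => ?_
    rw [Fintype.card_fin, numBlocks]
    have := Nat.div_add_mod' (2 ^ (j : ℕ)) (blockLen n)
    exact_mod_cast this.symm
  linarith

theorem mem_freeIdx (a : Idx J) :
    a ∈ freeIdx n J ↔ numBlocks n a.1 ≤ (a.2 : ℕ) / blockLen n := by simp [freeIdx]

/-- The rescaled block statistic `n S²`, for the rescaled mean `√n θ`. -/
def blockStat {n : ℝ} {J : ℕ} (m z : Idx J → ℝ) (b : BlockIdx n J) : ℝ :=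
  ∑ a ∈ block b, (m a + z a) ^ 2

theorem blockSq_obs (hn : 1 < n) (θ z : Idx J → ℝ) (b : BlockIdx n J) :
    blockSq n (obs n θ z) b.1 b.2 = blockStat (fun a => √n * θ a) z b / n := by
  rw [blockStat, sum_block_eq, Finset.sum_div, blockSq]
  refine Finset.sum_congr rfl fun k _ => ?_
  have hn0 : 0 < n := by linarith
  have hs : √n ≠ 0 := (Real.sqrt_pos.2 hn0).ne'
  have hsq : √n ^ 2 = n := Real.sq_sqrt hn0.le
  simp only [obs]
  have e : √n * θ ⟨b.1, k⟩ + z ⟨b.1, k⟩ = √n * (θ ⟨b.1, k⟩ + z ⟨b.1, k⟩ / √n) := by field_simp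
  rw [e, mul_pow, hsq, mul_div_cancel_left₀ _ hn0.ne']

theorem blockSq_le_threshold_iff (hn : 1 < n) (θ z : Idx J → ℝ) (b : BlockIdx n J) :
    blockSq n (obs n θ z) b.1 b.2 ≤ threshold n ↔
      blockStat (fun a => √n * θ a) z b ≤ lambdaStar * blockLen n := by
  rw [blockSq_obs hn, threshold, div_le_div_iff_of_pos_right (by linarith)]

theorem blockSq_lt_threshold_iff (hn : 1 < n) (θ z : Idx J → ℝ) (b : BlockIdx n J) :
    blockSq n (obs n θ z) b.1 b.2 < threshold n ↔
      blockStat (fun a => √n * θ a) z b < lambdaStar * blockLen n := by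
  rw [blockSq_obs hn, threshold, div_lt_div_iff_of_pos_right (by linarith)]

open Classical in
-- A kept coefficient errs by z/√n, a killed one by θ. Killing is decided blockwise, so each block
-- falls wholly under one case.
theorem mul_sum_sq_sub_center (hn : 1 < n) (θ z : Idx J → ℝ) :
    n * ∑ a, (θ a - center n (obs n θ z) a) ^ 2 =
      ∑ b : BlockIdx n J, (if blockStat (fun a => √n * θ a) z b < lambdaStar * blockLen n
        then ∑ a ∈ block b, (√n * θ a) ^ 2 else ∑ a ∈ block b, z a ^ 2) +
      ∑ a ∈ freeIdx n J, z a ^ 2 := by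
  have hn0 : 0 < n := by linarith
  have hs : √n ≠ 0 := (Real.sqrt_pos.2 hn0).ne'
  have hsq : √n ^ 2 = n := Real.sq_sqrt hn0.le
  have hkeep : ∀ a : Idx J, n * (θ a - obs n θ z a) ^ 2 = z a ^ 2 := by
    intro a
    simp only [obs]
    nth_rewrite 1 [← hsq]
    field_simp
    ring
  rw [Finset.mul_sum, sum_eq_blocks_add_free hn]
  congr 1
  · refine Finset.sum_congr rfl fun b _ => ?_
    split_ifs with h
    · refine Finset.sum_congr rfl fun a ha => ?_
      obtain ⟨h1, h2⟩ := (mem_block hn _ _).1 ha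
      have hc : center n (obs n θ z) a = 0 := by
        rw [center, if_pos]
        rw [h2, h1]
        exact ⟨b.2.2, (blockSq_lt_threshold_iff hn θ z b).2 h⟩
      rw [hc, mul_pow, hsq, sub_zero]
    · refine Finset.sum_congr rfl fun a ha => ?_
      obtain ⟨h1, h2⟩ := (mem_block hn _ _).1 ha
      have hc : center n (obs n θ z) a = obs n θ z a := by
        rw [center, if_neg]
        rw [h2, h1]
        exact fun h' => h ((blockSq_lt_threshold_iff hn θ z b).1 h'.2)
      rw [hc, hkeep]
  · refine Finset.sum_congr rfl fun a ha => ?_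
    have hc : center n (obs n θ z) a = obs n θ z a := by
      rw [center, if_neg]
      exact fun h' => absurd h'.1 (not_lt.2 ((mem_freeIdx a).1 ha))
    rw [hc, hkeep]

open Classical in
/-- The contribution of a block to the unbiased estimate of the squared loss. -/
def killedExcess {n : ℝ} {J : ℕ} (m z : Idx J → ℝ) (b : BlockIdx n J) : ℝ :=
  if blockStat m z b ≤ lambdaStar * blockLen n then blockStat m z b - blockLen n else 0

open Classical in
theorem mul_radiusSq (hn : 1 < n) (α : ℝ) (θ z : Idx J → ℝ) :
    n * radiusSq n α (obs n θ z) =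
      baseCost α * √(dim J) +
      ∑ j : Fin J, max 0 (∑ i : Fin (numBlocks n j),
        killedExcess (fun a => √n * θ a) z (⟨j, i⟩ : BlockIdx n J)) +
      keepCost * ∑ b : BlockIdx n J,
        (if lambdaStar * blockLen n < blockStat (fun a => √n * θ a) z b then
          (blockLen n : ℝ) else 0) +
      keepCost * (freeIdx n J).card := by
  have hn0 : 0 < n := by linarith
  rw [radiusSq, mul_add, mul_add, mul_add]
  congr 1
  · congr 1
    · congr 1
      · field_simp
      · rw [Finset.mul_sum]
        refine Finset.sum_congr rfl fun j _ => ?_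
        rw [mul_max_of_nonneg _ _ hn0.le, mul_zero, ← Fin.sum_univ_eq_sum_range
          (fun i => if blockSq n (obs n θ z) j i ≤ threshold n then
            blockSq n (obs n θ z) j i - blockLen n / n else 0), Finset.mul_sum]
        congr 1
        refine Finset.sum_congr rfl fun i _ => ?_
        have h1 := blockSq_le_threshold_iff hn θ z ⟨j, i⟩
        have h2 := blockSq_obs hn θ z ⟨j, i⟩
        dsimp only at h1 h2
        rw [killedExcess]
        split_ifs with h4 h5 h5
        · rw [h2]; field_simp
        · exact absurd (h1.1 h4) h5
        · exact absurd (h1.2 h5) h4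
        · simp
    · have h3 : ∑ j : Fin J, (((Finset.range (numBlocks n j)).filter
          fun i => threshold n < blockSq n (obs n θ z) j i).card : ℝ) =
          ∑ b : BlockIdx n J, if threshold n < blockSq n (obs n θ z) b.1 b.2 then (1 : ℝ) else 0 := by
        rw [← sum_levels_eq_sum_blockIdx
          (fun j i => if threshold n < blockSq n (obs n θ z) j i then (1 : ℝ) else 0)]
        refine Finset.sum_congr rfl fun j _ => ?_
        rw [Finset.card_filter]
        push_cast
        rfl
      rw [h3, Finset.mul_sum, Finset.mul_sum, Finset.mul_sum]
      refine Finset.sum_congr rfl fun b _ => ?_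
      have h1 := (blockSq_le_threshold_iff hn θ z b).not
      rw [not_le, not_le] at h1
      simp only [h1]
      split_ifs
      · field_simp
      · simp
  · rw [card_freeIdx hn]
    field_simp

end Blocks

/-! ### Numerical bounds on the constants -/

section Constants

theorem lambdaStar_pos : 0 < lambdaStar := by linarith [lambdaStar_spec.1]

theorem five_lt_lambdaStar : 5 < lambdaStar := by
  have h := lambdaStar_spec
  have := Real.log_pos h.1
  linarith [h.2]

theorem le_keepCost : 25 ≤ keepCost := by
  have h := five_lt_lambdaStar
  have : 2 ≤ √lambdaStar := Real.le_sqrt_of_sq_le (by linarith)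
  rw [keepCost]; linarith

theorem baseCost_nonneg {α : ℝ} (h0 : 0 < α) (h1 : α < 1) : 0 ≤ baseCost α := by
  have := (zQuantile_spec (a := α / 2) (by linarith) (by linarith)).1
  rw [baseCost]
  positivity

end Constants

/-! ### Coverage of the ball -/

section Coverage

variable {n : ℝ} {J : ℕ}

instance : IsProbabilityMeasure (noise J) := by rw [noise]; infer_instance

open Classical in
/-- The blocks whose rescaled mean is small enough for them to be killed. -/
def smallBlocks (n : ℝ) {J : ℕ} (m : Idx J → ℝ) : Finset (BlockIdx n J) :=
  Finset.univ.filter fun b => ∑ a ∈ block b, m a ^ 2 ≤ 4 * lambdaStar * blockLen n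

open Classical in
/-- The coefficients in the small blocks. -/
def smallIdx (n : ℝ) {J : ℕ} (m : Idx J → ℝ) : Finset (Idx J) := (smallBlocks n m).biUnion block

theorem mem_smallBlocks (m : Idx J → ℝ) (b : BlockIdx n J) :
    b ∈ smallBlocks n m ↔ ∑ a ∈ block b, m a ^ 2 ≤ 4 * lambdaStar * blockLen n := by
  simp [smallBlocks]

theorem sum_smallIdx (hn : 1 < n) (m f : Idx J → ℝ) :
    ∑ a ∈ smallIdx n m, f a = ∑ b ∈ smallBlocks n m, ∑ a ∈ block b, f a := by
  classical
  rw [smallIdx, Finset.sum_biUnion]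
  exact fun b _ b' _ hbb => disjoint_block hn hbb

theorem sum_sq_smallIdx_le (hn : 1 < n) (m : Idx J → ℝ) :
    ∑ a ∈ smallIdx n m, m a ^ 2 ≤ 4 * lambdaStar * dim J := by
  have hl := lambdaStar_pos
  rw [sum_smallIdx hn]
  calc _ ≤ ∑ b ∈ smallBlocks n m, 4 * lambdaStar * blockLen n :=
        Finset.sum_le_sum fun b hb => (mem_smallBlocks m b).1 hb
    _ = 4 * lambdaStar * ((smallBlocks n m).card * blockLen n) := by
        rw [Finset.sum_const, nsmul_eq_mul]; ring
    _ ≤ 4 * lambdaStar * dim J := by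
        rw [dim_eq_blocks_add_free hn]
        have h1 : ((smallBlocks n m).card : ℝ) ≤ Fintype.card (BlockIdx n J) := by
          exact_mod_cast Finset.card_le_univ _
        have h2 : ((smallBlocks n m).card : ℝ) * blockLen n ≤
            Fintype.card (BlockIdx n J) * blockLen n := by gcongr
        have h3 : (0 : ℝ) ≤ (freeIdx n J).card := Nat.cast_nonneg _
        gcongr
        linarith

open Classical in
/-- The loss in a block is at most its share of the radius, outside the exceptional events. -/
theorem block_loss_le (m z : Idx J → ℝ) (b : BlockIdx n J)
    (h1 : ∑ a ∈ block b, z a ^ 2 ≤ lambdaStar * blockLen n)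
    (h2 : b ∈ smallBlocks n m → ∑ a ∈ block b, 2 * m a * z a ≤ 8 * √lambdaStar * blockLen n)
    (h3 : blockStat m z b ≠ lambdaStar * blockLen n) :
    (if blockStat m z b < lambdaStar * blockLen n then ∑ a ∈ block b, m a ^ 2
      else ∑ a ∈ block b, z a ^ 2) ≤
    killedExcess m z b +
      keepCost * (if lambdaStar * blockLen n < blockStat m z b then (blockLen n : ℝ) else 0) +
      if b ∈ smallBlocks n m then
        ∑ a ∈ block b, (1 - z a ^ 2) + ∑ a ∈ block b, -(2 * m a) * z a else 0 := by
  have hl := five_lt_lambdaStar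
  have hL : (0 : ℝ) ≤ blockLen n := Nat.cast_nonneg _
  have hs := Real.sqrt_nonneg lambdaStar
  have hsL := mul_nonneg hs hL
  have hlL := mul_nonneg lambdaStar_pos.le hL
  have e1 : ∑ a ∈ block b, (1 - z a ^ 2) = blockLen n - ∑ a ∈ block b, z a ^ 2 := by
    rw [Finset.sum_sub_distrib, Finset.sum_const, card_block, nsmul_eq_mul, mul_one]
  have e2 : ∑ a ∈ block b, -(2 * m a) * z a = -∑ a ∈ block b, 2 * m a * z a := by
    rw [← Finset.sum_neg_distrib]
    exact Finset.sum_congr rfl fun a _ => by ring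
  rw [e1, e2, killedExcess, keepCost]
  rcases lt_or_gt_of_ne h3 with h | h
  -- A killed block is small: m² ≤ 2(m + z)² + 2z², and both sums over the block are at most λL.
  · have hsmall : b ∈ smallBlocks n m := by
      rw [mem_smallBlocks]
      have : ∑ a ∈ block b, m a ^ 2 ≤ 2 * blockStat m z b + 2 * ∑ a ∈ block b, z a ^ 2 := by
        rw [blockStat, Finset.mul_sum, Finset.mul_sum, ← Finset.sum_add_distrib]
        exact Finset.sum_le_sum fun a _ => by nlinarith [sq_nonneg (m a + 2 * z a)]
      nlinarith
    rw [if_pos h, if_pos h.le, if_neg h.le.not_gt, if_pos hsmall]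
    have e3 : blockStat m z b = ∑ a ∈ block b, m a ^ 2 + ∑ a ∈ block b, 2 * m a * z a +
        ∑ a ∈ block b, z a ^ 2 := by
      rw [blockStat, ← Finset.sum_add_distrib, ← Finset.sum_add_distrib]
      exact Finset.sum_congr rfl fun a _ => by ring
    rw [e3]
    linarith
  -- A kept small block must cover Σ z² - (L - Σ z²) + Σ 2mz ≤ (2λ - 1 + 8√λ)L, which is exactly
  -- `keepCost` times L. A kept block that is not small needs only λL.
  · rw [if_neg h.le.not_gt, if_neg h.not_ge, if_pos h]
    split_ifs with hsmall
    · have := h2 hsmall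
      nlinarith
    · nlinarith

/-- The ball covers outside the exceptional events. -/
theorem mem_confBall_of_good (hn : 1 < n) (α : ℝ) (θ z : Idx J → ℝ)
    (h1 : ∀ b : BlockIdx n J, ∑ a ∈ block b, z a ^ 2 ≤ lambdaStar * blockLen n)
    (h2 : ∀ b ∈ smallBlocks n (fun a => √n * θ a),
      ∑ a ∈ block b, 2 * (√n * θ a) * z a ≤ 8 * √lambdaStar * blockLen n)
    (h3 : ∀ b : BlockIdx n J, blockStat (fun a => √n * θ a) z b ≠ lambdaStar * blockLen n)
    (h4 : ∑ a ∈ freeIdx n J, z a ^ 2 ≤ keepCost * (freeIdx n J).card)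
    (h5 : ∑ a ∈ smallIdx n (fun a => √n * θ a), (1 - z a ^ 2) ≤
      2 * √(Real.log (2 / α)) * √(dim J))
    (h6 : ∑ a ∈ smallIdx n (fun a => √n * θ a), -(2 * (√n * θ a)) * z a ≤
      4 * √lambdaStar * √(dim J) * zQuantile (α / 2)) :
    θ ∈ confBall n α (obs n θ z) := by
  classical
  have hn0 : 0 < n := by linarith
  refine Real.sqrt_le_sqrt ?_
  refine le_of_mul_le_mul_left ?_ hn0
  rw [mul_sum_sq_sub_center hn, mul_radiusSq hn]
  have hb := Finset.sum_le_sum fun b (_ : b ∈ Finset.univ) =>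
    block_loss_le (fun a => √n * θ a) z b (h1 b) (h2 b) (h3 b)
  rw [Finset.sum_add_distrib, Finset.sum_add_distrib, Finset.sum_ite_mem, Finset.univ_inter,
    Finset.sum_add_distrib, ← sum_smallIdx hn, ← sum_smallIdx hn, ← Finset.mul_sum] at hb
  -- Taking positive parts level by level can only enlarge the radius.
  have hpos : ∑ b : BlockIdx n J, killedExcess (fun a => √n * θ a) z b ≤
      ∑ j : Fin J, max 0 (∑ i : Fin (numBlocks n j),
        killedExcess (fun a => √n * θ a) z (⟨j, i⟩ : BlockIdx n J)) := by
    rw [Fintype.sum_sigma]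
    exact Finset.sum_le_sum fun j _ => le_max_right _ _
  rw [baseCost]
  linarith

/-- Levels with 2^j < L contain no complete block, so all their coefficients are free, and together
they number at least L - 1. The condition log n ≤ N ensures that all these levels are present. -/
theorem card_freeIdx_ge (hn : 1 < n) (hJ : Real.log n ≤ dim J) :
    (blockLen n : ℝ) - 1 ≤ (freeIdx n J).card := by
  have hL := blockLen_pos hn
  have hLJ : blockLen n + 1 ≤ 2 ^ J := by
    have : blockLen n ≤ 2 ^ J - 1 := by
      refine Nat.ceil_le.2 (hJ.trans (le_of_eq ?_))
      rw [dim, Nat.cast_sub Nat.one_le_two_pow]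
      push_cast
      rfl
    have := Nat.one_le_two_pow (n := J)
    omega
  have hc : Nat.clog 2 (blockLen n) ≤ J := Nat.clog_le_of_le_pow (by omega)
  rw [card_freeIdx hn, Fin.sum_univ_eq_sum_range (fun j => ((2 ^ j % blockLen n : ℕ) : ℝ))]
  calc (blockLen n : ℝ) - 1 ≤ 2 ^ Nat.clog 2 (blockLen n) - 1 := by
        have := Nat.le_pow_clog (b := 2) (by norm_num) (blockLen n)
        have h : ((blockLen n : ℕ) : ℝ) ≤ ((2 ^ Nat.clog 2 (blockLen n) : ℕ) : ℝ) := by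
          exact_mod_cast this
        push_cast at h
        linarith
    _ = ∑ j ∈ Finset.range (Nat.clog 2 (blockLen n)), (2 : ℝ) ^ j := by
        rw [geom_sum_eq (by norm_num)]; norm_num
    _ ≤ ∑ j ∈ Finset.range (Nat.clog 2 (blockLen n)), ((2 ^ j % blockLen n : ℕ) : ℝ) := by
        refine Finset.sum_le_sum fun j hj => ?_
        have hj' : 2 ^ j < blockLen n :=
          (Nat.lt_clog_iff_pow_lt (by norm_num)).1 (Finset.mem_range.1 hj)
        rw [Nat.mod_eq_of_lt hj']
        push_cast
        rfl
    _ ≤ _ := Finset.sum_le_sum_of_subset_of_nonneg (Finset.range_mono hc)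
        fun _ _ _ => Nat.cast_nonneg _

theorem measure_block_noise_le (b : BlockIdx n J) :
    (noise J).real {z | lambdaStar * blockLen n ≤ ∑ a ∈ block b, z a ^ 2} ≤
      Real.exp (-(2 * blockLen n)) := by
  have h := tail_noncentral_chiSq (block b) (fun _ => 0) lambdaStar_spec.1
  simp only [zero_add, card_block] at h
  refine h.trans (Real.exp_le_exp.2 (le_of_eq ?_))
  have := lambdaStar_spec.2
  have e : lambdaStar - 1 - Real.log lambdaStar = 4 := by linarith
  rw [e]
  simp
  ring

theorem measure_block_cross_le (m : Idx J → ℝ) (b : BlockIdx n J) (hb : b ∈ smallBlocks n m) :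
    (noise J).real {z | 8 * √lambdaStar * blockLen n ≤ ∑ a ∈ block b, 2 * m a * z a} ≤
      Real.exp (-(2 * blockLen n)) := by
  have hl := lambdaStar_pos
  have hs : 0 < √lambdaStar := Real.sqrt_pos.2 hl
  have hsq : √lambdaStar ^ 2 = lambdaStar := Real.sq_sqrt hl.le
  have h := tail_linear (block b) (fun a => 2 * m a) (8 * √lambdaStar * blockLen n)
    (t := (2 * √lambdaStar)⁻¹) (by positivity)
  -- With t = 1/(2√λ) the linear term is -4L; the quadratic term is Σ m²/(2λ) ≤ 2L on a small block.
  refine h.trans (Real.exp_le_exp.2 ?_)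
  have h1 := (mem_smallBlocks m b).1 hb
  simp only [mul_pow, ← Finset.mul_sum, mul_inv]
  rw [inv_pow √lambdaStar, hsq]
  have e1 : 2⁻¹ * (√lambdaStar)⁻¹ * (8 * √lambdaStar * blockLen n) = 4 * blockLen n := by
    field_simp; ring
  rw [e1]
  have h2 : lambdaStar⁻¹ * ∑ a ∈ block b, m a ^ 2 ≤ 4 * blockLen n := by
    rw [inv_mul_le_iff₀ hl]; linarith
  nlinarith

/-- With R free coefficients, R ≥ max(1, L - 1) gives L ≤ 2R, hence exp(-4R) ≤ exp(-2L) ≤ n⁻². The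
factor 2R/L ≥ 1 is inserted so that this bound adds up with those of the blocks to a multiple of N.
-/
theorem measure_free_le (hn : 1 < n) (hJ : Real.log n ≤ dim J) :
    (noise J).real {z | keepCost * (freeIdx n J).card < ∑ a ∈ freeIdx n J, z a ^ 2} ≤
      2 * (freeIdx n J).card / (blockLen n * n ^ 2) := by
  have hn0 : 0 < n := by linarith
  have hL : 1 ≤ blockLen n := blockLen_pos hn
  have hL0 : (0 : ℝ) < blockLen n := by exact_mod_cast hL
  have hR := card_freeIdx_ge hn hJ
  rcases (freeIdx n J).eq_empty_or_nonempty with h0 | h0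
  · simp [h0]
  have hR1 : (1 : ℝ) ≤ (freeIdx n J).card := by exact_mod_cast h0.card_pos
  have hR2 : (blockLen n : ℝ) ≤ 2 * (freeIdx n J).card := by
    linarith
  have h1 : (noise J).real {z | keepCost * (freeIdx n J).card < ∑ a ∈ freeIdx n J, z a ^ 2} ≤
      Real.exp (-(4 * (freeIdx n J).card)) := by
    refine le_trans ?_ (tail_chiSq_large (freeIdx n J) le_keepCost)
    refine measureReal_mono (μ := noise J) fun z hz => ?_
    simp only [Set.mem_ofPred_eq] at hz ⊢
    exact hz.le
  refine h1.trans ?_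
  have h2 : Real.exp (-(4 * (freeIdx n J).card)) ≤ (n ^ 2)⁻¹ := by
    rw [Real.exp_neg]
    refine inv_anti₀ (by positivity) ?_
    calc n ^ 2 ≤ Real.exp (blockLen n) ^ 2 := by gcongr; exact le_exp_blockLen hn
      _ = Real.exp (2 * blockLen n) := by rw [← Real.exp_nat_mul]; norm_num
      _ ≤ _ := Real.exp_le_exp.2 (by linarith)
  refine h2.trans ?_
  rw [inv_eq_one_div, div_le_div_iff₀ (by positivity) (by positivity)]
  nlinarith [sq_nonneg n]

theorem measure_smallIdx_chiSq_le {α : ℝ} (h0 : 0 < α) (h1 : α < 1)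
    (hN : 0 < dim J) (m : Idx J → ℝ) :
    (noise J).real {z | 2 * √(Real.log (2 / α)) * √(dim J) ≤
      ∑ a ∈ smallIdx n m, (1 - z a ^ 2)} ≤ α / 2 := by
  have hlog : 0 ≤ Real.log (2 / α) := Real.log_nonneg (by rw [le_div_iff₀ h0]; linarith)
  refine (lower_tail_chiSq (smallIdx n m) hN ?_ (by positivity)).trans (le_of_eq ?_)
  · rw [dim_eq_card]; exact_mod_cast Finset.card_le_univ _
  · rw [mul_pow, mul_pow, Real.sq_sqrt hlog, Real.sq_sqrt hN.le]
    have : 2 ^ 2 * Real.log (2 / α) * dim J / (4 * dim J) = Real.log (2 / α) := by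
      field_simp; ring
    rw [this, Real.exp_neg, Real.exp_log (by positivity), inv_div]

theorem measure_smallIdx_cross_le (hn : 1 < n) {α : ℝ} (h0 : 0 < α) (h1 : α < 1)
    (hN : 0 < dim J) (m : Idx J → ℝ) :
    (noise J).real {z | 4 * √lambdaStar * √(dim J) * zQuantile (α / 2) <
      ∑ a ∈ smallIdx n m, -(2 * m a) * z a} ≤ α / 2 := by
  classical
  have hl := lambdaStar_pos
  have h := tail_linear_quantile (fun a => if a ∈ smallIdx n m then -(2 * m a) else 0)
    (σ := 4 * √lambdaStar * √(dim J)) (p := α / 2) (by linarith) (by linarith)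
    (by positivity) (by
      simp only [ite_pow]
      rw [zero_pow two_ne_zero, Finset.sum_ite_mem, Finset.univ_inter, mul_pow, mul_pow,
        Real.sq_sqrt hl.le, Real.sq_sqrt hN.le]
      have := sum_sq_smallIdx_le hn m
      simp only [neg_sq, mul_pow, ← Finset.mul_sum]
      linarith)
  simp only [ite_mul, zero_mul, Finset.sum_ite_mem, Finset.univ_inter] at h
  exact h

theorem coverage (hn : 1 < n) (hJ : Real.log n ≤ dim J) (hJ2 : dim J ≤ n ^ 2) {α : ℝ}
    (h0 : 0 < α) (h1 : α < 1) (θ : Idx J → ℝ) :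
    1 - α - 2 / Real.log n ≤ (noise J).real {z | θ ∈ confBall n α (obs n θ z)} := by
  classical
  have hn0 : 0 < n := by linarith
  have hlog : 0 < Real.log n := Real.log_pos hn
  have hN : 0 < dim J := by linarith
  have hL : 1 ≤ blockLen n := blockLen_pos hn
  have hL0 : (0 : ℝ) < blockLen n := by exact_mod_cast hL
  set m : Idx J → ℝ := fun a => √n * θ a with hm
  set E1 : Set (Idx J → ℝ) := ⋃ b ∈ (Finset.univ : Finset (BlockIdx n J)),
    {z | lambdaStar * blockLen n ≤ ∑ a ∈ block b, z a ^ 2} with hE1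
  set E2 : Set (Idx J → ℝ) := ⋃ b ∈ smallBlocks n m,
    {z | 8 * √lambdaStar * blockLen n ≤ ∑ a ∈ block b, 2 * m a * z a} with hE2
  set E3 : Set (Idx J → ℝ) := ⋃ b ∈ (Finset.univ : Finset (BlockIdx n J)),
    {z | blockStat m z b = lambdaStar * blockLen n} with hE3
  set E4 : Set (Idx J → ℝ) :=
    {z | keepCost * (freeIdx n J).card < ∑ a ∈ freeIdx n J, z a ^ 2} with hE4
  set E5 : Set (Idx J → ℝ) := {z | 2 * √(Real.log (2 / α)) * √(dim J) ≤
      ∑ a ∈ smallIdx n m, (1 - z a ^ 2)} with hE5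
  set E6 : Set (Idx J → ℝ) := {z | 4 * √lambdaStar * √(dim J) * zQuantile (α / 2) <
      ∑ a ∈ smallIdx n m, -(2 * m a) * z a} with hE6
  set G : Set (Idx J → ℝ) := {z | θ ∈ confBall n α (obs n θ z)} with hG
  have hcover : Set.univ ⊆ G ∪ (E1 ∪ (E2 ∪ (E3 ∪ (E4 ∪ (E5 ∪ E6))))) := by
    intro z _
    by_contra hz
    simp only [Set.mem_union, not_or] at hz
    obtain ⟨hz0, hz1, hz2, hz3, hz4, hz5, hz6⟩ := hz
    simp only [hE1, hE2, hE3, Set.mem_iUnion, not_exists, Finset.mem_univ, forall_true_left,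
      Set.mem_ofPred_eq] at hz1 hz2 hz3
    refine hz0 (mem_confBall_of_good hn α θ z (fun b => (not_le.1 (hz1 b)).le)
      (fun b hb => (not_le.1 (hz2 b hb)).le) hz3 (not_lt.1 hz4) (not_le.1 hz5).le (not_lt.1 hz6))
  set e := Real.exp (-(2 * (blockLen n : ℝ))) with he
  have he0 : 0 < e := Real.exp_pos _
  have hm1 : (noise J).real E1 ≤ Fintype.card (BlockIdx n J) * e := by
    refine (measureReal_biUnion_finset_le _ _).trans ((Finset.sum_le_sum fun b _ =>
      measure_block_noise_le b).trans (le_of_eq ?_))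
    rw [Finset.sum_const, nsmul_eq_mul, Finset.card_univ]
  have hm2 : (noise J).real E2 ≤ Fintype.card (BlockIdx n J) * e := by
    refine (measureReal_biUnion_finset_le _ _).trans ((Finset.sum_le_sum fun b hb =>
      measure_block_cross_le m b hb).trans ?_)
    rw [Finset.sum_const, nsmul_eq_mul]
    refine mul_le_mul_of_nonneg_right ?_ he0.le
    exact_mod_cast Finset.card_le_univ _
  have hm3 : (noise J).real E3 = 0 := by
    refine le_antisymm ((measureReal_biUnion_finset_le _ _).trans (le_of_eq ?_)) measureReal_nonneg
    refine Finset.sum_eq_zero fun b _ => ?_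
    rw [measureReal_def, noise]
    have hne : (block b).Nonempty := Finset.card_pos.1 (by rw [card_block]; exact hL)
    have := measure_noncentral_chiSq_eq (block b) hne m (lambdaStar * blockLen n)
    simp only [blockStat]
    rw [this, ENNReal.toReal_zero]
  have hm4 : (noise J).real E4 ≤ _ := measure_free_le hn hJ
  have hm5 : (noise J).real E5 ≤ α / 2 := measure_smallIdx_chiSq_le h0 h1 hN m
  have hm6 : (noise J).real E6 ≤ α / 2 := measure_smallIdx_cross_le hn h0 h1 hN m
  have htot : 1 ≤ (noise J).real G + ((noise J).real E1 + ((noise J).real E2 +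
      ((noise J).real E3 + ((noise J).real E4 + ((noise J).real E5 + (noise J).real E6))))) := by
    calc (1 : ℝ) = (noise J).real Set.univ := probReal_univ.symm
      _ ≤ _ := measureReal_mono hcover
      _ ≤ _ := (measureReal_union_le _ _).trans (add_le_add_right ((measureReal_union_le _ _).trans
        (add_le_add_right ((measureReal_union_le _ _).trans (add_le_add_right
        ((measureReal_union_le _ _).trans (add_le_add_right ((measureReal_union_le _ _).trans
        (add_le_add_right (measureReal_union_le _ _) _)) _)) _)) _)) _)
  -- With K blocks and R free coefficients, KL + R = N, so the three terms sum to at most 2N/(L n²),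
  -- and N ≤ n².
  have hbudget : Fintype.card (BlockIdx n J) * e + Fintype.card (BlockIdx n J) * e +
      2 * (freeIdx n J).card / (blockLen n * n ^ 2) ≤ 2 / Real.log n := by
    have he2 : e ≤ (n ^ 2)⁻¹ := by
      rw [he, Real.exp_neg]
      refine inv_anti₀ (by positivity) ?_
      calc n ^ 2 ≤ Real.exp (blockLen n) ^ 2 := by gcongr; exact le_exp_blockLen hn
        _ = Real.exp (2 * blockLen n) := by rw [← Real.exp_nat_mul]; norm_num
    calc _ ≤ Fintype.card (BlockIdx n J) * (n ^ 2)⁻¹ + Fintype.card (BlockIdx n J) * (n ^ 2)⁻¹ +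
          2 * (freeIdx n J).card / (blockLen n * n ^ 2) := by gcongr
      _ = 2 * dim J / (blockLen n * n ^ 2) := by
          rw [dim_eq_blocks_add_free hn]; field_simp; ring
      _ ≤ 2 * n ^ 2 / (blockLen n * n ^ 2) := by gcongr
      _ = 2 / blockLen n := by field_simp
      _ ≤ 2 / Real.log n := by gcongr; exact log_le_blockLen n
  linarith

end Coverage

/-! ### Level energies on a Besov body -/

section Besov

theorem abs_apply_le_norm_toLp {κ : Type*} [Fintype κ] {q : ℝ≥0∞} (hq : 0 < q) (x : κ → ℝ)
    (i : κ) : |x i| ≤ ‖(WithLp.toLp q x : PiLp q fun _ : κ => ℝ)‖ := by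
  rcases eq_or_ne q ∞ with rfl | hq'
  · rw [PiLp.norm_eq_ciSup]
    exact le_ciSup (f := fun i => ‖x i‖) (Set.finite_range _).bddAbove i
  · have hq0 : 0 < q.toReal := ENNReal.toReal_pos hq.ne' hq'
    rw [PiLp.norm_eq_sum hq0, one_div]
    rw [Real.le_rpow_inv_iff_of_pos (abs_nonneg _)
      (Finset.sum_nonneg fun i _ => Real.rpow_nonneg (norm_nonneg _) _) hq0]
    exact Finset.single_le_sum (f := fun i => ‖x i‖ ^ q.toReal)
      (fun i _ => Real.rpow_nonneg (norm_nonneg _) _) (Finset.mem_univ i)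

theorem norm_toLp_nonneg {κ : Type*} [Fintype κ] {q : ℝ≥0∞} (hq : 0 < q) (x : κ → ℝ) :
    0 ≤ ‖(WithLp.toLp q x : PiLp q fun _ : κ => ℝ)‖ := by
  rcases eq_or_ne q ∞ with rfl | hq'
  · rw [PiLp.norm_eq_ciSup]
    exact Real.iSup_nonneg fun i => norm_nonneg _
  · rw [PiLp.norm_eq_sum (ENNReal.toReal_pos hq.ne' hq')]
    exact Real.rpow_nonneg (Finset.sum_nonneg fun i _ => Real.rpow_nonneg (norm_nonneg _) _) _

/-- The power mean inequality between the exponents `2` and `p`. -/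
theorem sum_sq_le_norm_toLp {κ : Type*} [Fintype κ] [Nonempty κ] {p : ℝ≥0∞} (hp : 2 ≤ p)
    (x : κ → ℝ) :
    ∑ i, x i ^ 2 ≤ (Fintype.card κ : ℝ) ^ (1 - 2 * (p.toReal)⁻¹) *
      ‖(WithLp.toLp p x : PiLp p fun _ : κ => ℝ)‖ ^ 2 := by
  have hp0 : 0 < p := lt_of_lt_of_le (by norm_num) hp
  have hcard : (0 : ℝ) < Fintype.card κ := by exact_mod_cast Fintype.card_pos
  rcases eq_or_ne p ∞ with rfl | hp'
  · simp only [ENNReal.toReal_top, inv_zero, mul_zero, sub_zero, Real.rpow_one]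
    rw [← nsmul_eq_mul, ← Finset.card_univ]
    refine Finset.sum_le_card_nsmul _ _ _ fun i _ => ?_
    rw [← sq_abs]
    exact pow_le_pow_left₀ (abs_nonneg _) (abs_apply_le_norm_toLp hp0 x i) 2
  · have hpr : 2 ≤ p.toReal := by
      have := ENNReal.toReal_mono hp' hp
      simpa using this
    set r := p.toReal with hr
    have hr0 : 0 < r := by linarith
    have h := Real.rpow_sum_le_const_mul_sum_rpow (Finset.univ : Finset κ) (fun i => x i ^ 2)
      (p := r / 2) (by linarith)
    have e1 : ∀ i, |x i ^ 2| = x i ^ 2 := fun i => abs_of_nonneg (sq_nonneg _)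
    have e2 : ∀ i, (x i ^ 2) ^ (r / 2) = ‖x i‖ ^ r := by
      intro i
      rw [← sq_abs, ← Real.rpow_natCast, ← Real.rpow_mul (abs_nonneg _), Real.norm_eq_abs]
      congr 1; push_cast; ring
    simp only [e1, e2, Finset.card_univ] at h
    have hS : 0 ≤ ∑ i, ‖x i‖ ^ r :=
      Finset.sum_nonneg fun i _ => Real.rpow_nonneg (norm_nonneg _) _
    have h2 := Real.rpow_le_rpow (Real.rpow_nonneg (Finset.sum_nonneg fun i _ => sq_nonneg _) _) h
      (z := 2 / r) (by positivity)
    rw [← Real.rpow_mul (Finset.sum_nonneg fun i _ => sq_nonneg _),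
      Real.mul_rpow (Real.rpow_nonneg hcard.le _) hS, ← Real.rpow_mul hcard.le] at h2
    have e3 : r / 2 * (2 / r) = 1 := by field_simp
    have e4 : (r / 2 - 1) * (2 / r) = 1 - 2 * r⁻¹ := by field_simp
    rw [e3, Real.rpow_one, e4] at h2
    refine h2.trans (le_of_eq ?_)
    rw [PiLp.norm_eq_sum hr0]
    congr 1
    rw [← Real.rpow_natCast _ 2, ← Real.rpow_mul hS]
    congr 1
    push_cast
    ring

/-- The power mean factor 2^{j(1-2/p)} cancels against the weight 2^{2js} up to 2^{-2τj}. The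
exponent q enters only through the bound of a coordinate by the whole, which also holds for q < 1.
-/
theorem level_sum_sq_le_of_mem_besovBody {J : ℕ} {τ M : ℝ} {p q : ℝ≥0∞} (hp : 2 ≤ p)
    (hq : 0 < q) {θ : Idx J → ℝ} (hθ : θ ∈ besovBody J τ p q M) (j : Fin J) :
    ∑ k, θ ⟨j, k⟩ ^ 2 ≤ M ^ 2 * ((2 : ℝ) ^ (j : ℕ)) ^ (-(2 * τ)) := by
  have hp0 : 0 < p := lt_of_lt_of_le (by norm_num) hp
  have h1 := (abs_apply_le_norm_toLp hq _ j).trans hθ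
  set A := ‖(WithLp.toLp p fun k : Fin (2 ^ (j : ℕ)) => θ ⟨j, k⟩ :
          PiLp p fun _ : Fin (2 ^ (j : ℕ)) => ℝ)‖ with hA
  have hA0 : 0 ≤ A := norm_toLp_nonneg hp0 _
  have h2 := sum_sq_le_norm_toLp hp (fun k : Fin (2 ^ (j : ℕ)) => θ ⟨j, k⟩)
  rw [← hA, Fintype.card_fin] at h2
  push_cast at h2
  refine h2.trans ?_
  set u := (p.toReal)⁻¹
  have h3 : (2 : ℝ) ^ ((j : ℝ) * (τ + 1 / 2 - u)) * A ≤ M := (le_abs_self _).trans h1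
  have h4 : ((2 : ℝ) ^ ((j : ℝ) * (τ + 1 / 2 - u)) * A) ^ 2 ≤ M ^ 2 :=
    pow_le_pow_left₀ (by positivity) h3 2
  have e : ((2 : ℝ) ^ (j : ℕ)) ^ (1 - 2 * u) * A ^ 2 =
      ((2 : ℝ) ^ ((j : ℝ) * (τ + 1 / 2 - u)) * A) ^ 2 * ((2 : ℝ) ^ (j : ℕ)) ^ (-(2 * τ)) := by
    rw [mul_pow, ← Real.rpow_natCast 2 (j : ℕ), ← Real.rpow_mul (by norm_num),
      ← Real.rpow_mul (by norm_num), ← Real.rpow_natCast (_ ^ _) 2, ← Real.rpow_mul (by norm_num),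
      mul_right_comm, ← Real.rpow_add (by norm_num)]
    congr 2
    push_cast
    ring
  rw [e]
  gcongr

end Besov

/-! ### Sums over the levels -/

section Sums

theorem sqrt_two_pow (j : ℕ) : √((2 : ℝ) ^ j) = √2 ^ j := by
  rw [Real.sqrt_eq_iff_mul_self_eq (by positivity) (by positivity), ← mul_pow,
    Real.mul_self_sqrt (by norm_num)]

theorem sum_sqrt_level_le (J : ℕ) : ∑ j : Fin J, √(2 * 2 ^ (j : ℕ)) ≤ 4 * √(dim J) := by
  have h2 : √2 ^ 2 = (2 : ℝ) := Real.sq_sqrt (by norm_num)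
  have h2' : 1 < √2 := Real.lt_sqrt_of_sq_lt (by norm_num)
  have h2'' : √2 ≤ 2 := Real.sqrt_le_iff.2 ⟨by norm_num, by norm_num⟩
  have e : ∀ j : Fin J, √(2 * 2 ^ (j : ℕ)) = √2 * √2 ^ (j : ℕ) := fun j => by
    rw [Real.sqrt_mul (by norm_num), sqrt_two_pow]
  simp only [e]
  rw [← Finset.mul_sum, Fin.sum_univ_eq_sum_range (fun j => √2 ^ j), geom_sum_eq h2'.ne']
  have hx : 1 ≤ √2 ^ J := one_le_pow₀ h2'.le
  have h3 : √2 ^ J - 1 ≤ √(dim J) := by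
    refine Real.le_sqrt_of_sq_le ?_
    have : dim J = (√2 ^ J) ^ 2 - 1 := by
      rw [← pow_mul, mul_comm, pow_mul, h2, dim]
    rw [this]
    nlinarith
  -- The constant 4 of the statement is a bound for √2/(√2 - 1) = 2 + √2.
  have h4 : √2 * ((√2 ^ J - 1) / (√2 - 1)) = (2 + √2) * (√2 ^ J - 1) := by
    have : √2 - 1 ≠ 0 := by linarith
    field_simp
    linear_combination (1 : ℝ) * h2 - h2 * √2 ^ J
  rw [h4]
  exact mul_le_mul (by linarith) h3 (by linarith) (by norm_num)

/-- The sum over levels of the smaller of the dimension and the energy of a Besov ball. -/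
theorem sum_min_level_le {τ : ℝ} (hτ : 0 < τ) {T : ℝ} (hT : 1 ≤ T) (J : ℕ) :
    ∑ j ∈ Finset.range J, min ((2 : ℝ) ^ j) (T ^ (1 + 2 * τ) * ((2 : ℝ) ^ j) ^ (-(2 * τ))) ≤
      (2 + (1 - (2 : ℝ) ^ (-(2 * τ)))⁻¹) * T := by
  have hT0 : 0 < T := by linarith
  -- The two terms of the minimum cross near 2^j = T. Up to level k the dimensions sum to at most
  -- 2T; beyond it the energies decay geometrically from T with ratio 2^{-2τ}.
  obtain ⟨k, hk1, hk2⟩ := exists_nat_pow_near hT (one_lt_two (α := ℝ))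
  set ρ : ℝ := (2 : ℝ) ^ (-(2 * τ)) with hρ
  have hρ0 : 0 < ρ := by positivity
  have hρ1 : ρ < 1 := Real.rpow_lt_one_of_one_lt_of_neg (by norm_num) (by linarith)
  set g : ℕ → ℝ := fun j => min ((2 : ℝ) ^ j) (T ^ (1 + 2 * τ) * ((2 : ℝ) ^ j) ^ (-(2 * τ))) with hg
  have hg0 : ∀ j, 0 ≤ g j := fun j => le_min (by positivity) (by positivity)
  have hlow : ∑ j ∈ Finset.range (k + 1), g j ≤ 2 * T := by
    calc _ ≤ ∑ j ∈ Finset.range (k + 1), (2 : ℝ) ^ j := Finset.sum_le_sum fun j _ => min_le_left _ _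
      _ = 2 ^ (k + 1) - 1 := by rw [geom_sum_eq (by norm_num)]; norm_num
      _ ≤ 2 * T := by rw [pow_succ]; linarith
  have hhigh : ∀ x, g (k + 1 + x) ≤ T * ρ ^ x := by
    intro x
    refine (min_le_right _ _).trans ?_
    have h1 : T ^ (1 + 2 * τ) * ((2 : ℝ) ^ (k + 1 + x)) ^ (-(2 * τ)) =
        T * ((2 : ℝ) ^ (k + 1 + x) / T) ^ (-(2 * τ)) := by
      rw [Real.div_rpow (by positivity) hT0.le, Real.rpow_add hT0, Real.rpow_one,
        Real.rpow_neg hT0.le]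
      field_simp
    have h2 : ((2 : ℝ) ^ (k + 1 + x) / T) ^ (-(2 * τ)) ≤ ((2 : ℝ) ^ x) ^ (-(2 * τ)) := by
      refine Real.rpow_le_rpow_of_nonpos (by positivity) ?_ (by linarith)
      rw [le_div_iff₀ hT0, pow_add, mul_comm]
      gcongr
    have h3 : ((2 : ℝ) ^ x) ^ (-(2 * τ)) = ρ ^ x := by
      rw [hρ, ← Real.rpow_natCast, ← Real.rpow_natCast, ← Real.rpow_mul (by norm_num),
        ← Real.rpow_mul (by norm_num), mul_comm]
    rw [h1, ← h3]
    gcongr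
  calc ∑ j ∈ Finset.range J, g j ≤ ∑ j ∈ Finset.range (k + 1 + J), g j :=
        Finset.sum_le_sum_of_subset_of_nonneg (Finset.range_mono (by omega)) fun j _ _ => hg0 j
    _ = ∑ j ∈ Finset.range (k + 1), g j + ∑ x ∈ Finset.range J, g (k + 1 + x) :=
        Finset.sum_range_add _ _ _
    _ ≤ 2 * T + ∑ x ∈ Finset.range J, T * ρ ^ x :=
        add_le_add hlow (Finset.sum_le_sum fun x _ => hhigh x)
    _ ≤ 2 * T + T * (1 - ρ)⁻¹ := by
        rw [← Finset.mul_sum]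
        gcongr
        rw [← tsum_geometric_of_lt_one hρ0.le hρ1]
        exact (summable_geometric_of_lt_one hρ0.le hρ1).sum_le_tsum _ fun x _ => by positivity
    _ = _ := by ring

theorem card_freeIdx_le_rpow {n : ℝ} {J : ℕ} (hn : 1 < n) (hJ : dim J ≤ n ^ 2) {δ : ℝ}
    (hδ : 0 < δ) : ((freeIdx n J).card : ℝ) ≤ 3 * (1 + 2 / δ) ^ 2 * n ^ δ := by
  have hn0 : 0 < n := by linarith
  have hL := blockLen_pos hn
  have hlog := Real.log_pos hn
  have h1 : ((freeIdx n J).card : ℝ) ≤ J * blockLen n := by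
    rw [card_freeIdx hn]
    calc _ ≤ ∑ _j : Fin J, (blockLen n : ℝ) := Finset.sum_le_sum fun j _ => by
          exact_mod_cast (Nat.mod_lt _ hL).le
      _ = _ := by simp
  -- From 2^J ≤ n² + 1 ≤ 2n² and 2/log 2 < 3.
  have h2 : (J : ℝ) ≤ 1 + 3 * Real.log n := by
    have h3 : (2 : ℝ) ^ J ≤ 2 * n ^ 2 := by rw [dim] at hJ; nlinarith
    have h4 := Real.log_le_log (by positivity) h3
    rw [Real.log_pow, Real.log_mul (by norm_num) (by positivity), Real.log_pow] at h4
    push_cast at h4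
    have h5 := Real.log_two_gt_d9
    have h6 : (J : ℝ) * Real.log 2 ≤ (1 + 3 * Real.log n) * Real.log 2 := by nlinarith
    exact le_of_mul_le_mul_right h6 (by linarith)
  have h3 : (blockLen n : ℝ) ≤ Real.log n + 1 := (Nat.ceil_lt_add_one hlog.le).le
  have h4 : Real.log n ≤ n ^ (δ / 2) / (δ / 2) := Real.log_le_rpow_div hn0.le (by linarith)
  have h5 : 1 ≤ n ^ (δ / 2) := Real.one_le_rpow hn.le (by linarith)
  have h6 : 1 + Real.log n ≤ (1 + 2 / δ) * n ^ (δ / 2) := by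
    have : n ^ (δ / 2) / (δ / 2) = 2 / δ * n ^ (δ / 2) := by field_simp
    rw [this] at h4
    nlinarith
  have h7 : n ^ δ = n ^ (δ / 2) * n ^ (δ / 2) := by rw [← Real.rpow_add hn0]; ring_nf
  calc ((freeIdx n J).card : ℝ) ≤ J * blockLen n := h1
    _ ≤ (1 + 3 * Real.log n) * (Real.log n + 1) := by gcongr
    _ ≤ 3 * ((1 + Real.log n) * (1 + Real.log n)) := by nlinarith
    _ ≤ 3 * (((1 + 2 / δ) * n ^ (δ / 2)) * ((1 + 2 / δ) * n ^ (δ / 2))) := by gcongr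
    _ = _ := by rw [h7]; ring

end Sums

/-! ### Expectation of the squared radius -/

section Expectation

variable {n : ℝ} {J : ℕ}

theorem measurable_blockStat (m : Idx J → ℝ) (b : BlockIdx n J) :
    Measurable fun z => blockStat m z b := by
  unfold blockStat
  fun_prop

theorem measurable_killedExcess (m : Idx J → ℝ) (b : BlockIdx n J) :
    Measurable fun z => killedExcess m z b := by
  unfold killedExcess
  have := measurable_blockStat m b
  exact Measurable.ite (measurableSet_le this measurable_const) (this.sub_const _) measurable_const

theorem killedExcess_le (m z : Idx J → ℝ) (b : BlockIdx n J) :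
    killedExcess m z b ≤ (lambdaStar - 1) * blockLen n := by
  have := lambdaStar_spec.1
  have hL : (0 : ℝ) ≤ blockLen n := Nat.cast_nonneg _
  rw [killedExcess]
  split_ifs
  · linarith
  · nlinarith

/-- Truncation only discards nonnegative terms: a kept block has excess above (λ - 1)L ≥ 0. -/
theorem killedExcess_le_sum (m z : Idx J → ℝ) (b : BlockIdx n J) :
    killedExcess m z b ≤ ∑ a ∈ block b, ((m a + z a) ^ 2 - 1) := by
  have := lambdaStar_spec.1
  have hL : (0 : ℝ) ≤ blockLen n := Nat.cast_nonneg _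
  rw [Finset.sum_sub_distrib, Finset.sum_const, card_block, nsmul_eq_mul, mul_one, killedExcess,
    ← blockStat]
  split_ifs with h
  · exact le_rfl
  · push Not at h
    nlinarith

theorem numBlocks_mul_le (j : Fin J) : (numBlocks n j : ℝ) * blockLen n ≤ 2 ^ (j : ℕ) := by
  exact_mod_cast Nat.div_mul_le_self (2 ^ (j : ℕ)) (blockLen n)

theorem sum_blocks_level_le (hn : 1 < n) (j : Fin J) (f : Idx J → ℝ) (hf : ∀ a, 0 ≤ f a) :
    ∑ i : Fin (numBlocks n j), ∑ a ∈ block (⟨j, i⟩ : BlockIdx n J), f a ≤ ∑ k, f ⟨j, k⟩ := by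
  classical
  rw [← Finset.sum_biUnion]
  · rw [show ∑ k, f ⟨j, k⟩ = ∑ a ∈ Finset.univ.map (Function.Embedding.sigmaMk j), f a from
      (Finset.sum_map Finset.univ (Function.Embedding.sigmaMk j) f).symm]
    refine Finset.sum_le_sum_of_subset_of_nonneg (fun a ha => ?_) fun a _ _ => hf a
    simp only [Finset.mem_biUnion, Finset.mem_univ, true_and] at ha
    obtain ⟨i, hi⟩ := ha
    obtain ⟨j', k⟩ := a
    have h := ((mem_block hn _ _).1 hi).1
    dsimp only at h
    subst h
    exact Finset.mem_map.2 ⟨k, Finset.mem_univ _, rfl⟩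
  · intro i _ i' _ hii
    refine disjoint_block hn fun h => hii ?_
    exact eq_of_heq (Sigma.mk.inj_iff.1 h).2

/-- The rescaled radius contribution of a level. -/
theorem integral_level_le (hn : 1 < n) (m : Idx J → ℝ) (j : Fin J) :
    Integrable (fun z => max 0 (∑ i : Fin (numBlocks n j),
      killedExcess m z (⟨j, i⟩ : BlockIdx n J))) (noise J) ∧
    ∫ z, max 0 (∑ i : Fin (numBlocks n j), killedExcess m z (⟨j, i⟩ : BlockIdx n J)) ∂noise J ≤
      √(2 * 2 ^ (j : ℕ)) + (lambdaStar + 3) * min (2 ^ (j : ℕ)) (∑ k, m ⟨j, k⟩ ^ 2) := by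
  classical
  have hl := lambdaStar_spec.1
  set A := ∑ k, m ⟨j, k⟩ ^ 2 with hA
  have hA0 : 0 ≤ A := Finset.sum_nonneg fun _ _ => sq_nonneg _
  have h2j : (0 : ℝ) < 2 ^ (j : ℕ) := by positivity
  have hbd : ∀ z, max 0 (∑ i : Fin (numBlocks n j), killedExcess m z (⟨j, i⟩ : BlockIdx n J)) ≤
      lambdaStar * 2 ^ (j : ℕ) := by
    intro z
    refine max_le (by positivity) ?_
    calc _ ≤ ∑ _i : Fin (numBlocks n j), (lambdaStar - 1) * (blockLen n : ℝ) :=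
          Finset.sum_le_sum fun i _ => killedExcess_le m z _
      _ = (lambdaStar - 1) * (numBlocks n j * blockLen n) := by
          rw [Finset.sum_const, Finset.card_univ, Fintype.card_fin, nsmul_eq_mul]; ring
      _ ≤ (lambdaStar - 1) * 2 ^ (j : ℕ) :=
          mul_le_mul_of_nonneg_left (numBlocks_mul_le j) (by linarith)
      _ ≤ _ := by nlinarith
  have hmeas : Measurable fun z => max 0 (∑ i : Fin (numBlocks n j),
      killedExcess m z (⟨j, i⟩ : BlockIdx n J)) :=
    measurable_const.max (Finset.measurable_sum _ fun i _ => measurable_killedExcess m _)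
  have hint : Integrable (fun z => max 0 (∑ i : Fin (numBlocks n j),
      killedExcess m z (⟨j, i⟩ : BlockIdx n J))) (noise J) :=
    Integrable.of_bound hmeas.aestronglyMeasurable (lambdaStar * 2 ^ (j : ℕ))
      (ae_of_all _ fun z => by
        rw [Real.norm_eq_abs, abs_of_nonneg (le_max_left _ _)]
        exact hbd z)
  refine ⟨hint, ?_⟩
  -- Two bounds give the minimum: the truncated statistic is at most λ2^j surely, and dropping the
  -- truncation leaves a centred chi-square sum, whose positive part has mean at most its mean plus
  -- its standard deviation.
  have hbig : ∫ z, max 0 (∑ i : Fin (numBlocks n j),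
      killedExcess m z (⟨j, i⟩ : BlockIdx n J)) ∂noise J ≤ lambdaStar * 2 ^ (j : ℕ) := by
    refine (integral_mono hint (integrable_const _) hbd).trans (le_of_eq ?_)
    simp
  set s : Finset (Idx J) := Finset.univ.biUnion
    fun i : Fin (numBlocks n j) => block (⟨j, i⟩ : BlockIdx n J) with hs
  have hsum : ∀ f : Idx J → ℝ, ∑ a ∈ s, f a =
      ∑ i : Fin (numBlocks n j), ∑ a ∈ block (⟨j, i⟩ : BlockIdx n J), f a := by
    intro f
    rw [hs, Finset.sum_biUnion]
    intro i _ i' _ hii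
    exact disjoint_block hn fun h => hii (eq_of_heq (Sigma.mk.inj_iff.1 h).2)
  have hsA : ∑ a ∈ s, m a ^ 2 ≤ A := by
    rw [hsum]; exact sum_blocks_level_le hn j (fun a => m a ^ 2) fun a => sq_nonneg _
  have hsc : (s.card : ℝ) ≤ 2 ^ (j : ℕ) := by
    have h1 := hsum fun _ => 1
    simp only [Finset.sum_const, nsmul_eq_mul, mul_one, card_block, Finset.card_univ,
      Fintype.card_fin] at h1
    rw [h1]; exact numBlocks_mul_le j
  obtain ⟨hi2, hle2⟩ := integral_pos_part_centered_le s m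
  have hsmall : ∫ z, max 0 (∑ i : Fin (numBlocks n j),
      killedExcess m z (⟨j, i⟩ : BlockIdx n J)) ∂noise J ≤ √(2 * 2 ^ (j : ℕ)) + 3 * A := by
    refine (integral_mono hint hi2 fun z => max_le_max le_rfl ?_).trans (hle2.trans ?_)
    · rw [hsum]
      exact Finset.sum_le_sum fun i _ => killedExcess_le_sum m z _
    · have h1 : √(2 * s.card + 4 * ∑ a ∈ s, m a ^ 2) ≤ √(2 * 2 ^ (j : ℕ)) + 2 * A := by
        refine Real.sqrt_le_iff.2 ⟨by positivity, ?_⟩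
        have h2 : √(2 * (2 : ℝ) ^ (j : ℕ)) ^ 2 = 2 * 2 ^ (j : ℕ) := Real.sq_sqrt (by positivity)
        have h3 : 1 ≤ √(2 * (2 : ℝ) ^ (j : ℕ)) := by
          refine Real.le_sqrt_of_sq_le ?_
          have : (1 : ℝ) ≤ 2 ^ (j : ℕ) := one_le_pow₀ (by norm_num)
          linarith
        nlinarith
      linarith
  have hsq := Real.sqrt_nonneg (2 * (2 : ℝ) ^ (j : ℕ))
  rcases le_total ((2 : ℝ) ^ (j : ℕ)) A with h | h
  · rw [min_eq_left h]; nlinarith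
  · rw [min_eq_right h]; nlinarith

open Classical in
/-- The expected cost of keeping a block. -/
theorem integral_kept_le (hn : 1 < n) (m : Idx J → ℝ) (b : BlockIdx n J) {δ : ℝ} (hδ : 0 < δ)
    (hδ2 : δ ≤ 1) :
    Integrable (fun z => if lambdaStar * blockLen n < blockStat m z b then
      (blockLen n : ℝ) else 0) (noise J) ∧
    ∫ z, (if lambdaStar * blockLen n < blockStat m z b then (blockLen n : ℝ) else 0) ∂noise J ≤
      blockLen n * n ^ (-(2 - δ)) +
        min (blockLen n : ℝ) ((lambdaStar - 1) / (2 * δ) * ∑ a ∈ block b, m a ^ 2) := by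
  have hl := lambdaStar_spec.1
  have hn0 : 0 < n := by linarith
  have hL : (0 : ℝ) ≤ blockLen n := Nat.cast_nonneg _
  set A := ∑ a ∈ block b, m a ^ 2 with hA
  have hA0 : 0 ≤ A := Finset.sum_nonneg fun _ _ => sq_nonneg _
  have hms : MeasurableSet {z | lambdaStar * blockLen n < blockStat m z b} :=
    measurableSet_lt measurable_const (measurable_blockStat m b)
  have hfun : (fun z => if lambdaStar * blockLen n < blockStat m z b then
      (blockLen n : ℝ) else 0) =
      Set.indicator {z | lambdaStar * blockLen n < blockStat m z b} fun _ => (blockLen n : ℝ) := by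
    funext z
    simp [Set.indicator_apply]
  rw [hfun]
  refine ⟨(integrable_const _).indicator hms, ?_⟩
  rw [integral_indicator_const _ hms, smul_eq_mul, mul_comm]
  have hnp : 0 ≤ n ^ (-(2 - δ)) := by positivity
  -- If the energy is large, the trivial probability bound 1 costs L. Otherwise noncentrality adds
  -- at most δL to the exponent -2L, and L ≥ log n.
  rcases le_total (blockLen n : ℝ) ((lambdaStar - 1) / (2 * δ) * A) with h | h
  · rw [min_eq_left h]
    have h1 : (noise J).real {z | lambdaStar * blockLen n < blockStat m z b} ≤ 1 :=
      measureReal_le_one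
    nlinarith [mul_nonneg hL hnp]
  · have h0 : 0 ≤ (lambdaStar - 1) / (2 * δ) * A :=
      mul_nonneg (div_nonneg (by linarith) (by linarith)) hA0
    rw [min_eq_right h]
    have h1 : (noise J).real {z | lambdaStar * blockLen n < blockStat m z b} ≤ n ^ (-(2 - δ)) := by
      have h2 := tail_noncentral_chiSq (block b) m hl
      rw [card_block] at h2
      have h3 : (noise J).real {z | lambdaStar * blockLen n < blockStat m z b} ≤
          (noise J).real {z | lambdaStar * blockLen n ≤ ∑ a ∈ block b, (m a + z a) ^ 2} := by
        refine measureReal_mono fun z hz => ?_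
        simp only [Set.mem_ofPred_eq] at hz ⊢
        exact hz.le
      refine h3.trans (h2.trans ?_)
      rw [Real.rpow_def_of_pos hn0, Real.exp_le_exp]
      have e : lambdaStar - 1 - Real.log lambdaStar = 4 := by linarith [lambdaStar_spec.2]
      rw [e, ← hA]
      have h4 : (lambdaStar - 1) / 2 * A ≤ δ * blockLen n := by
        have : (lambdaStar - 1) / 2 * A = δ * ((lambdaStar - 1) / (2 * δ) * A) := by field_simp
        rw [this]; gcongr
      have h5 := log_le_blockLen n
      nlinarith
    nlinarith [mul_le_mul_of_nonneg_left h1 hL]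

theorem sum_kept_level_le (hn : 1 < n) (m : Idx J → ℝ) (j : Fin J) {c : ℝ} (hc : 0 ≤ c) :
    ∑ i : Fin (numBlocks n j), min (blockLen n : ℝ)
      (c * ∑ a ∈ block (⟨j, i⟩ : BlockIdx n J), m a ^ 2) ≤
      (1 + c) * min (2 ^ (j : ℕ)) (∑ k, m ⟨j, k⟩ ^ 2) := by
  set A := ∑ k, m ⟨j, k⟩ ^ 2 with hA
  have hA0 : 0 ≤ A := Finset.sum_nonneg fun _ _ => sq_nonneg _
  have h2j : (0 : ℝ) < 2 ^ (j : ℕ) := by positivity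
  have h1 : ∑ i : Fin (numBlocks n j), min (blockLen n : ℝ)
      (c * ∑ a ∈ block (⟨j, i⟩ : BlockIdx n J), m a ^ 2) ≤ 2 ^ (j : ℕ) := by
    refine (Finset.sum_le_sum fun i _ => min_le_left _ _).trans ?_
    rw [Finset.sum_const, Finset.card_univ, Fintype.card_fin, nsmul_eq_mul]
    exact numBlocks_mul_le j
  have h2 : ∑ i : Fin (numBlocks n j), min (blockLen n : ℝ)
      (c * ∑ a ∈ block (⟨j, i⟩ : BlockIdx n J), m a ^ 2) ≤ c * A := by
    refine (Finset.sum_le_sum fun i _ => min_le_right _ _).trans ?_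
    rw [← Finset.mul_sum]
    exact mul_le_mul_of_nonneg_left
      (sum_blocks_level_le hn j (fun a => m a ^ 2) fun a => sq_nonneg _) hc
  rcases le_total ((2 : ℝ) ^ (j : ℕ)) A with h | h
  · rw [min_eq_left h]; nlinarith
  · rw [min_eq_right h]; nlinarith

open Classical in
/-- The expected squared radius in terms of the energies of the levels. -/
theorem integral_radius_sq_le (hn : 1 < n) {α : ℝ} (h0 : 0 < α) (h1 : α < 1) (θ : Idx J → ℝ)
    {δ : ℝ} (hδ : 0 < δ) (hδ2 : δ ≤ 1) :
    Integrable (fun z => radius n α (obs n θ z) ^ 2) (noise J) ∧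
    n * ∫ z, radius n α (obs n θ z) ^ 2 ∂noise J ≤
      (baseCost α + 4) * √(dim J) +
      (lambdaStar + 3 + keepCost * (1 + (lambdaStar - 1) / (2 * δ))) *
        ∑ j : Fin J, min (2 ^ (j : ℕ)) (∑ k, (√n * θ ⟨j, k⟩) ^ 2) +
      keepCost * (dim J * n ^ (-(2 - δ))) + keepCost * (freeIdx n J).card := by
  have hn0 : 0 < n := by linarith
  have hl := lambdaStar_spec.1
  have hK : 0 ≤ keepCost := by linarith [le_keepCost]
  set m : Idx J → ℝ := fun a => √n * θ a with hm
  have hB := baseCost_nonneg h0 h1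
  have hnonneg : ∀ z, 0 ≤ n * radiusSq n α (obs n θ z) := by
    intro z
    rw [mul_radiusSq hn]
    have e1 : 0 ≤ ∑ j : Fin J, max 0 (∑ i : Fin (numBlocks n j),
        killedExcess (fun a => √n * θ a) z (⟨j, i⟩ : BlockIdx n J)) :=
      Finset.sum_nonneg fun j _ => le_max_left _ _
    have e2 : 0 ≤ ∑ b : BlockIdx n J,
        (if lambdaStar * blockLen n < blockStat (fun a => √n * θ a) z b then
          (blockLen n : ℝ) else 0) :=
      Finset.sum_nonneg fun b _ => by split_ifs <;> positivity
    positivity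
  have hrad : ∀ z, radius n α (obs n θ z) ^ 2 = n⁻¹ * (n * radiusSq n α (obs n θ z)) := by
    intro z
    have : 0 ≤ radiusSq n α (obs n θ z) := nonneg_of_mul_nonneg_right (hnonneg z) hn0
    rw [radius, Real.sq_sqrt this, inv_mul_cancel_left₀ hn0.ne']
  set Y : Fin J → (Idx J → ℝ) → ℝ := fun j z => max 0 (∑ i : Fin (numBlocks n j),
    killedExcess m z (⟨j, i⟩ : BlockIdx n J)) with hY
  set Z : BlockIdx n J → (Idx J → ℝ) → ℝ := fun b z =>
    if lambdaStar * blockLen n < blockStat m z b then (blockLen n : ℝ) else 0 with hZ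
  have hYi : ∀ j, Integrable (Y j) (noise J) := fun j => (integral_level_le hn m j).1
  have hZi : ∀ b, Integrable (Z b) (noise J) := fun b => (integral_kept_le hn m b hδ hδ2).1
  have hYs : Integrable (fun z => ∑ j, Y j z) (noise J) := integrable_finsetSum _ fun j _ => hYi j
  have hZs : Integrable (fun z => ∑ b, Z b z) (noise J) := integrable_finsetSum _ fun b _ => hZi b
  have hform : ∀ z, n * radiusSq n α (obs n θ z) = (baseCost α * √(dim J) +
      keepCost * (freeIdx n J).card) + (∑ j, Y j z + keepCost * ∑ b, Z b z) := by
    intro z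
    rw [mul_radiusSq hn]
    ring
  have hYZ : Integrable (fun z => ∑ j, Y j z + keepCost * ∑ b, Z b z) (noise J) :=
    hYs.add (hZs.const_mul _)
  have hF : Integrable (fun z => n * radiusSq n α (obs n θ z)) (noise J) := by
    simp only [hform]
    exact (integrable_const _).add hYZ
  simp only [hrad]
  refine ⟨hF.const_mul _, ?_⟩
  rw [integral_const_mul, mul_inv_cancel_left₀ hn0.ne']
  simp only [hform]
  rw [integral_add (integrable_const _) hYZ, integral_add hYs (hZs.const_mul _),
    integral_const_mul, integral_finsetSum _ fun j _ => hYi j,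
    integral_finsetSum _ fun b _ => hZi b]
  simp only [integral_const, probReal_univ, one_smul]
  set S := ∑ j : Fin J, min ((2 : ℝ) ^ (j : ℕ)) (∑ k, m ⟨j, k⟩ ^ 2) with hS
  have hYle : ∑ j, ∫ z, Y j z ∂noise J ≤ 4 * √(dim J) + (lambdaStar + 3) * S := by
    refine (Finset.sum_le_sum fun j _ => (integral_level_le hn m j).2).trans ?_
    rw [Finset.sum_add_distrib, ← Finset.mul_sum]
    linarith [sum_sqrt_level_le J]
  have hc : 0 ≤ (lambdaStar - 1) / (2 * δ) := div_nonneg (by linarith) (by linarith)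
  have hZle : ∑ b, ∫ z, Z b z ∂noise J ≤
      dim J * n ^ (-(2 - δ)) + (1 + (lambdaStar - 1) / (2 * δ)) * S := by
    refine (Finset.sum_le_sum fun b _ => (integral_kept_le hn m b hδ hδ2).2).trans ?_
    rw [Finset.sum_add_distrib]
    refine add_le_add ?_ ?_
    · rw [Finset.sum_const, nsmul_eq_mul, Finset.card_univ, ← mul_assoc]
      refine mul_le_mul_of_nonneg_right ?_ (by positivity)
      rw [dim_eq_blocks_add_free hn]
      have : (0 : ℝ) ≤ (freeIdx n J).card := Nat.cast_nonneg _
      linarith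
    · rw [Fintype.sum_sigma, hS, Finset.mul_sum]
      exact Finset.sum_le_sum fun j _ => sum_kept_level_le hn m j hc
  have := mul_le_mul_of_nonneg_left hZle hK
  linarith

end Expectation

/-! ### The risk bound over Besov bodies -/

section Risk

theorem risk_bound {τ : ℝ} (hτ : 0 < τ) : ∃ C : ℝ, 0 < C ∧
      ∀ (n : ℝ) (J : ℕ) (α : ℝ), 1 < n → dim J ≤ n ^ 2 → 0 < α → α < 1 →
      ∀ (p q : ℝ≥0∞) (M : ℝ), 2 ≤ p → 0 < q → 1 ≤ M →
      ∀ θ ∈ besovBody J τ p q M,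
        Integrable (fun z => radius n α (obs n θ z) ^ 2) (noise J) ∧
        ∫ z, radius n α (obs n θ z) ^ 2 ∂(noise J) ≤
          (2 * √(Real.log (2 / α)) + 4 * √lambdaStar * zQuantile (α / 2) + 4) *
              (√(dim J) / n)
            + C * min (dim J / n)
                (M ^ (2 / (1 + 2 * τ)) * n ^ (-(2 * τ) / (1 + 2 * τ))) := by
  have hl := lambdaStar_spec.1
  have hK : 0 < keepCost := by linarith [le_keepCost]
  have hτ1 : 0 < 1 + 2 * τ := by linarith
  -- This choice gives T = (M² n)^δ the property T^{1+2τ} = M² n. As M ≥ 1, also n^δ ≤ T, so T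
  -- absorbs both the falsely kept blocks, N n^{-(2-δ)} ≤ n^δ, and the free coefficients.
  set δ : ℝ := 1 / (1 + 2 * τ) with hδ
  have hδ0 : 0 < δ := by positivity
  have hδ1 : δ ≤ 1 := by rw [hδ, div_le_one hτ1]; linarith
  have hρ1 : (2 : ℝ) ^ (-(2 * τ)) < 1 :=
    Real.rpow_lt_one_of_one_lt_of_neg (by norm_num) (by linarith)
  set c₁ : ℝ := lambdaStar + 3 + keepCost * (1 + (lambdaStar - 1) / (2 * δ)) with hc₁
  have hc₁0 : 0 < c₁ := by
    have : 0 ≤ (lambdaStar - 1) / (2 * δ) := div_nonneg (by linarith) (by linarith)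
    positivity
  set c₂ : ℝ := 2 + (1 - (2 : ℝ) ^ (-(2 * τ)))⁻¹ with hc₂
  have hc₂1 : 1 ≤ c₂ := by
    have : 0 < (1 - (2 : ℝ) ^ (-(2 * τ)))⁻¹ := inv_pos.2 (by linarith)
    linarith
  set c₃ : ℝ := 3 * (1 + 2 / δ) ^ 2 with hc₃
  have hc₃1 : 1 ≤ c₃ := by
    have : 0 < 2 / δ := by positivity
    nlinarith
  refine ⟨c₁ * c₂ + keepCost + keepCost * c₃, by positivity, ?_⟩
  intro n J α hn hJ h0 h1 p q M hp hq hM θ hθ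
  have hn0 : 0 < n := by linarith
  have hM0 : 0 < M := by linarith
  obtain ⟨hint, hle⟩ := integral_radius_sq_le hn h0 h1 θ hδ0 hδ1
  refine ⟨hint, ?_⟩
  set N := dim J with hN
  have hN0 : 0 ≤ N := dim_nonneg J
  set T : ℝ := (M ^ 2 * n) ^ δ with hT
  have hMn : 1 ≤ M ^ 2 * n := by nlinarith
  have hT1 : 1 ≤ T := Real.one_le_rpow hMn hδ0.le
  have hTpow : T ^ (1 + 2 * τ) = M ^ 2 * n := by
    rw [hT, ← Real.rpow_mul (by positivity), hδ, one_div_mul_cancel hτ1.ne', Real.rpow_one]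
  have hnT : n ^ δ ≤ T := Real.rpow_le_rpow hn0.le (le_mul_of_one_le_left hn0.le (one_le_pow₀ hM)) hδ0.le
  have hS : ∑ j : Fin J, min ((2 : ℝ) ^ (j : ℕ)) (∑ k, (√n * θ ⟨j, k⟩) ^ 2) ≤ c₂ * min N T := by
    have hSN : ∑ j : Fin J, min ((2 : ℝ) ^ (j : ℕ)) (∑ k, (√n * θ ⟨j, k⟩) ^ 2) ≤ N := by
      rw [hN, dim_eq_sum]
      exact Finset.sum_le_sum fun j _ => min_le_left _ _
    have hST : ∑ j : Fin J, min ((2 : ℝ) ^ (j : ℕ)) (∑ k, (√n * θ ⟨j, k⟩) ^ 2) ≤ c₂ * T := by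
      refine le_trans ?_ (sum_min_level_le hτ hT1 J)
      rw [← Fin.sum_univ_eq_sum_range (fun j =>
        min ((2 : ℝ) ^ j) (T ^ (1 + 2 * τ) * ((2 : ℝ) ^ j) ^ (-(2 * τ))))]
      refine Finset.sum_le_sum fun j _ => min_le_min le_rfl ?_
      simp only [mul_pow, Real.sq_sqrt hn0.le, ← Finset.mul_sum]
      rw [hTpow, mul_comm (M ^ 2) n, mul_assoc]
      exact mul_le_mul_of_nonneg_left (level_sum_sq_le_of_mem_besovBody hp hq hθ j) hn0.le
    rcases min_choice N T with h | h
    · rw [h]; nlinarith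
    · rw [h]; exact hST
  have hD : N * n ^ (-(2 - δ)) ≤ min N T := by
    refine le_min ?_ ?_
    · have : n ^ (-(2 - δ)) ≤ 1 := Real.rpow_le_one_of_one_le_of_nonpos hn.le (by linarith)
      nlinarith
    · refine le_trans ?_ hnT
      calc N * n ^ (-(2 - δ)) ≤ n ^ 2 * n ^ (-(2 - δ)) := by gcongr
        _ = n ^ δ := by
          rw [← Real.rpow_natCast, ← Real.rpow_add hn0]
          congr 1; push_cast; ring
  have hR : ((freeIdx n J).card : ℝ) ≤ c₃ * min N T := by
    have hRN : ((freeIdx n J).card : ℝ) ≤ N := by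
      rw [hN, dim_eq_card]; exact_mod_cast Finset.card_le_univ _
    have hRT : ((freeIdx n J).card : ℝ) ≤ c₃ * T :=
      (card_freeIdx_le_rpow hn hJ hδ0).trans (by gcongr)
    rcases min_choice N T with h | h
    · rw [h]; nlinarith
    · rw [h]; exact hRT
  have hTn : M ^ (2 / (1 + 2 * τ)) * n ^ (-(2 * τ) / (1 + 2 * τ)) = T / n := by
    rw [hT, Real.mul_rpow (by positivity) hn0.le, ← Real.rpow_natCast M 2,
      ← Real.rpow_mul hM0.le, mul_div_assoc]
    nth_rewrite 3 [← Real.rpow_one n]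
    rw [← Real.rpow_sub hn0]
    congr 2
    · rw [hδ]; push_cast; ring
    · rw [hδ]; field_simp; ring
  rw [hTn, min_div_div_right hn0.le]
  have hfin : n * ∫ z, radius n α (obs n θ z) ^ 2 ∂noise J ≤
      (baseCost α + 4) * √N + (c₁ * c₂ + keepCost + keepCost * c₃) * min N T := by
    have g1 := mul_le_mul_of_nonneg_left hS hc₁0.le
    have g2 := mul_le_mul_of_nonneg_left hD hK.le
    have g3 := mul_le_mul_of_nonneg_left hR hK.le
    linarith
  refine le_of_mul_le_mul_left (hfin.trans (le_of_eq ?_)) hn0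
  rw [baseCost]
  field_simp

end Risk

end HonestBall

end

theorem theorem5 :
    (∀ (n : ℝ) (J : ℕ) (α : ℝ), 1 < n → Real.log n ≤ dim J → dim J ≤ n ^ 2 → 0 < α → α < 1 →
      ∀ θ : Idx J → ℝ,
        1 - α - 2 / Real.log n ≤ (noise J).real {z | θ ∈ confBall n α (obs n θ z)}) ∧
    (∀ τ : ℝ, 0 < τ → ∃ C : ℝ, 0 < C ∧
      ∀ (n : ℝ) (J : ℕ) (α : ℝ), 1 < n → dim J ≤ n ^ 2 → 0 < α → α < 1 →
      ∀ (p q : ℝ≥0∞) (M : ℝ), 2 ≤ p → 0 < q → 1 ≤ M →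
      ∀ θ ∈ besovBody J τ p q M,
        Integrable (fun z => radius n α (obs n θ z) ^ 2) (noise J) ∧
        ∫ z, radius n α (obs n θ z) ^ 2 ∂(noise J) ≤
          (2 * √(Real.log (2 / α)) + 4 * √lambdaStar * zQuantile (α / 2) + 4) *
              (√(dim J) / n)
            + C * min (dim J / n)
                (M ^ (2 / (1 + 2 * τ)) * n ^ (-(2 * τ) / (1 + 2 * τ)))) := by
  refine ⟨fun n J α hn hJ hJ2 h0 h1 θ => coverage hn hJ hJ2 h0 h1 θ, fun τ hτ => risk_bound hτ⟩
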